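/- Let $p$ be a prime, $k$ a field of characteristic $p$, $n\ge 0$, $A=k[x_1,\dots,x_n]$ graded by $\deg x_i=-1$, $I=(x_1,\dots,x_n)$. Let $G=(\mathbb Z/p)^n$ with standard generators $e_1,\dots,e_n$, $y_i=e_i-1\in k[G]$, and $J=(y_1,\dots,y_n)\subset k[G]$ the augmentation ideal. The Loewy length of a $k[G]$-module $V$ is $\mathit{ll}_{k[G]}V=\inf\{r\ge 0\mid J^rV=0\}$. A $p$-DG $A$-module is a $\mathbb Z$-graded $A$-module $M$ with an $A$-linear map $d$ of degree $-1$ such that $d^p=0$. It is free if the underlying graded $A$-module is a direct sum of shifts of $A$, and finitely generated if the underlying $A$-module is. For $1\le s\le p-1$ put ${}_sH_l(M)=\ker(d^s\colon M_l\to M_{l-s})/\operatorname{im}(d^{p-s}\colon M_{l+p-s}\to M_l)$; the inclusions $\ker d^s\subset\ker d^{s+1}$ induce $i_*\colon {}_sH_l\to{}_{s+1}H_l$ and $d$ induces $d_*\colon {}_{s+1}H_l\to{}_sH_{l-1}$ $(1\le s\le p-2)$. Two morphisms $f,g\colon M\to N$ (degree-$0$ $A$-linear maps commuting with $d$) are homotopic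 if $f-g=\sum_{i=0}^{p-1}d^{p-1-i}hd^i$ for some $A$-linear $h\colon M\to N$ of degree $p-1$; this defines chain homotopy equivalence. A composition series of $M$ of length $r$ is a filtration $0=M^0\subsetneq M^1\subsetneq\dots\subsetneq M^r=M$ by $p$-DG submodules such that each $M^i/M^{i-1}$ is a direct sum of shifts of $A$ (with zero differential), or a direct sum of shifts of $Av\oplus A\,dv\oplus\dots\oplus A\,d^{p-2}v$ (free on $v,dv,\dots,d^{p-2}v$, with $d^{p-1}v=0$). Let $M$ be a free, finitely generated $p$-DG $A$-module, and identify $M\otimes_Ak=M/IM$. Let $d^1\colon {}_sH_l(M/IM)\to{}_{p-s}H_{l-s}(IM/I^2M)\cong I/I^2\otimes_A{}_{p-s}H_{l-s+1}(M/IM)$ be the map $[m+IM]\mapsto[d^sm+I^2M]$, where the isomorphism is the inverse of $[f]\otimes[m]\mapsto[fm]$. Assume that: 1. for $l\equiv p-1 \pmod p$ the maps $i_*\colon {}_1H_l(M/IM)\to{}_2H_l(M/IM)\to\dots\to{}_{p-1}H_l(M/IM)$ are isomorphisms, and for $l\equiv p-2\pmod p$ the maps $d_*\colon {}_{p-1}H_l(M/IM)\to\dots\to{}_2H_{l-p+3}(M/IM)\to{}_1H_{l-p+2}(M/IM)$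 are isomorphisms; 2. $k[G]$ acts $k$-linearly on ${}_sH_l(M/IM)$ for all $1\le s\le p-1$ and $l\in\mathbb Z$, such that all $i_*$ and $d_*$ are equivariant; 3. for $l\equiv p-1\pmod p$, the composite of $d^1\colon {}_1H_l(M/IM)\to I/I^2\otimes_A{}_{p-1}H_l(M/IM)$ with the identification ${}_{p-1}H_l\cong{}_1H_l$ given by the maps $i_*$ is $\xi\mapsto\sum_i x_i\otimes y_i\xi$; 4. for $l\equiv p-2\pmod p$, the composite of $d^1\colon {}_{p-1}H_l(M/IM)\to I/I^2\otimes_A{}_1H_{l-p+2}(M/IM)$ with the identification ${}_1H_{l-p+2}\cong{}_{p-1}H_l$ given by the maps $d_*$ is $\xi\mapsto\sum_i x_i\otimes(p-1)y_i\xi$. Then $M$ is chain homotopy equivalent to a free, finitely generated $p$-DG $A$-module that admits a composition series of length $$\sum_{i\in\mathbb Z}\mathit{ll}_{k[G]}\,{}_1H_i(M\otimes_Ak).$$ -/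

import Mathlib

universe u v w

open scoped BigOperators

noncomputable section

/-- A `p`-differential graded module over `A = k[x_1, …, x_n]`, where `deg x_i = -1`: a `ℤ`-graded
`A`-module with an `A`-linear map `d` of degree `-1` such that `d ^ p = 0`.
The graded pieces are `k`-subspaces; since `A` is generated by the `x_i` as a `k`-algebra, the
condition `A_i M_j ⊆ M_{i+j}` says exactly that each `x_i` lowers the degree by one. -/
structure PDGModule (p n : ℕ) (k : Type u) [Field k] where
  carrier : Type v
  [addCommGroup : AddCommGroup carrier]
  [moduleK : Module k carrier]
  [moduleA : Module (MvPolynomial (Fin n) k) carrier]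
  [tower : IsScalarTower k (MvPolynomial (Fin n) k) carrier]
  gr : ℤ → Submodule k carrier
  isInternal : DirectSum.IsInternal gr
  X_smul_mem : ∀ (i : Fin n) (l : ℤ) (m : carrier), m ∈ gr l →
    (MvPolynomial.X i : MvPolynomial (Fin n) k) • m ∈ gr (l - 1)
  d : carrier →ₗ[MvPolynomial (Fin n) k] carrier
  d_mem : ∀ (l : ℤ) (m : carrier), m ∈ gr l → d m ∈ gr (l - 1)
  d_pow : d ^ p = 0

namespace PDGModule

attribute [instance] addCommGroup moduleK moduleA tower

section

variable {p n : ℕ} {k : Type u} [Field k]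

theorem d_pow_mem (M : PDGModule.{u, v} p n k) (r : ℕ) {l l' : ℤ} (h : l' = l - r) {m : M.carrier}
    (hm : m ∈ M.gr l) : (M.d ^ r) m ∈ M.gr l' := by
  induction r generalizing l' with
  | zero => simpa [h] using hm
  | succ r ih =>
    rw [pow_succ', Module.End.mul_apply]
    have h2 := M.d_mem (l - r) _ (ih rfl)
    have : l' = l - r - 1 := by push_cast at h; omega
    rwa [this]

/-- `M` is free: the underlying graded `A`-module is a direct sum of shifts of `A`, that is, it has
an `A`-basis of homogeneous elements. -/
def IsFree (M : PDGModule.{u, v} p n k) : Prop :=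
  ∃ (ι : Type v) (b : Module.Basis ι (MvPolynomial (Fin n) k) M.carrier) (c : ι → ℤ),
    ∀ i, b i ∈ M.gr (c i)

/-- `M` is finitely generated as an `A`-module. -/
def IsFG (M : PDGModule.{u, v} p n k) : Prop :=
  Module.Finite (MvPolynomial (Fin n) k) M.carrier

/-! ### Morphisms, homotopies, homotopy equivalences -/

/-- A morphism of `p`-DG modules: `A`-linear, of degree `0`, commuting with the differentials. -/
structure Hom (M : PDGModule.{u, v} p n k) (N : PDGModule.{u, w} p n k) where
  toLin : M.carrier →ₗ[MvPolynomial (Fin n) k] N.carrier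
  map_gr : ∀ (l : ℤ) (m : M.carrier), m ∈ M.gr l → toLin m ∈ N.gr l
  comm : toLin ∘ₗ M.d = N.d ∘ₗ toLin

/-- Two degree-`0` maps `f, g : M → N` are homotopic: `f - g = ∑_{i<p} d^{p-1-i} h d^i` for some
`A`-linear map `h` of degree `p - 1`. -/
def Homotopic {M : PDGModule.{u, v} p n k} {N : PDGModule.{u, w} p n k}
    (f g : M.carrier →ₗ[MvPolynomial (Fin n) k] N.carrier) : Prop :=
  ∃ h : M.carrier →ₗ[MvPolynomial (Fin n) k] N.carrier,
    (∀ (l : ℤ) (m : M.carrier), m ∈ M.gr l → h m ∈ N.gr (l + ((p : ℤ) - 1))) ∧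
    f - g = ∑ i ∈ Finset.range p, (N.d ^ (p - 1 - i)) ∘ₗ h ∘ₗ (M.d ^ i)

/-- `M` and `N` are chain homotopy equivalent. -/
def HomotopyEquivalent (M : PDGModule.{u, v} p n k) (N : PDGModule.{u, w} p n k) : Prop :=
  ∃ (f : Hom M N) (g : Hom N M),
    Homotopic (M := M) (N := M) (g.toLin ∘ₗ f.toLin) LinearMap.id ∧
    Homotopic (M := N) (N := N) (f.toLin ∘ₗ g.toLin) LinearMap.id

/-! ### The homology groups `_sH_l` -/

/-- `ker (d^s : M_l → M_{l-s})`. -/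
def cycles (M : PDGModule.{u, v} p n k) (s : ℕ) (l : ℤ) : Submodule k M.carrier :=
  M.gr l ⊓ LinearMap.ker ((M.d ^ s).restrictScalars k)

/-- `im (d^{p-s} : M_{l+p-s} → M_l)`. -/
def boundaries (M : PDGModule.{u, v} p n k) (s : ℕ) (l : ℤ) : Submodule k M.carrier :=
  (M.gr (l + ((p - s : ℕ) : ℤ))).map ((M.d ^ (p - s)).restrictScalars k)

theorem mem_cycles {M : PDGModule.{u, v} p n k} {s : ℕ} {l : ℤ} {m : M.carrier} :
    m ∈ M.cycles s l ↔ m ∈ M.gr l ∧ (M.d ^ s) m = 0 := Iff.rfl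

theorem mem_boundaries {M : PDGModule.{u, v} p n k} {s : ℕ} {l : ℤ} {m : M.carrier} :
    m ∈ M.boundaries s l ↔ ∃ x ∈ M.gr (l + ((p - s : ℕ) : ℤ)), (M.d ^ (p - s)) x = m := Iff.rfl

theorem boundaries_le_cycles (M : PDGModule.{u, v} p n k) {s : ℕ} (hs : s ≤ p) (l : ℤ) :
    M.boundaries s l ≤ M.cycles s l := by
  intro m hm
  obtain ⟨x, hx, rfl⟩ := mem_boundaries.1 hm
  refine mem_cycles.2 ⟨M.d_pow_mem _ (by omega) hx, ?_⟩
  rw [← Module.End.mul_apply, ← pow_add, Nat.add_sub_cancel' hs, M.d_pow]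
  rfl

/-- `_sH_l(M) = ker (d^s : M_l → M_{l-s}) / im (d^{p-s} : M_{l+p-s} → M_l)`. -/
abbrev H (M : PDGModule.{u, v} p n k) (s : ℕ) (l : ℤ) : Type v :=
  M.cycles s l ⧸ (M.boundaries s l).submoduleOf (M.cycles s l)

/-- The class in `_sH_l(M)` of a cycle. -/
def homClass (M : PDGModule.{u, v} p n k) (s : ℕ) (l : ℤ) (m : M.carrier)
    (hm : m ∈ M.cycles s l) : M.H s l :=
  Submodule.Quotient.mk ⟨m, hm⟩

/-- The map on homology induced by a `k`-linear map that preserves cycles and boundaries. -/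
def mapH {M : PDGModule.{u, v} p n k} {N : PDGModule.{u, w} p n k}
    (f : M.carrier →ₗ[k] N.carrier) (s t : ℕ) (l l' : ℤ)
    (hc : ∀ m ∈ M.cycles s l, f m ∈ N.cycles t l')
    (hb : ∀ m ∈ M.boundaries s l, f m ∈ N.boundaries t l') : M.H s l →ₗ[k] N.H t l' :=
  Submodule.mapQ _ _ (f.restrict hc) fun m hm => hb m.1 hm

theorem mapH_homClass {M : PDGModule.{u, v} p n k} {N : PDGModule.{u, w} p n k}
    (f : M.carrier →ₗ[k] N.carrier) (s t : ℕ) (l l' : ℤ)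
    (hc : ∀ m ∈ M.cycles s l, f m ∈ N.cycles t l')
    (hb : ∀ m ∈ M.boundaries s l, f m ∈ N.boundaries t l') (m : M.carrier)
    (hm : m ∈ M.cycles s l) :
    mapH f s t l l' hc hb (M.homClass s l m hm) = N.homClass t l' (f m) (hc m hm) := rfl

/-- The map `_sH_l(M) → _tH_l(M)`, `[m] ↦ [m]`, for `s ≤ t`, induced by `ker d^s ⊆ ker d^t`.
For `t = s + 1` this is `i_*`; in general it is `(i_*)^{t-s}`. -/
def iMap (M : PDGModule.{u, v} p n k) (s t : ℕ) (hst : s ≤ t) (l : ℤ) : M.H s l →ₗ[k] M.H t l :=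
  mapH LinearMap.id s t l l
    (fun m hm => by
      obtain ⟨h1, h2⟩ := mem_cycles.1 hm
      refine mem_cycles.2 ⟨h1, ?_⟩
      obtain ⟨e, rfl⟩ := Nat.exists_eq_add_of_le hst
      rw [LinearMap.id_apply, add_comm, pow_add, Module.End.mul_apply, h2, map_zero])
    (fun m hm => by
      obtain ⟨x, hx, rfl⟩ := mem_boundaries.1 hm
      obtain ⟨e, he⟩ := Nat.exists_eq_add_of_le (Nat.sub_le_sub_left hst p)
      refine mem_boundaries.2 ⟨(M.d ^ e) x, M.d_pow_mem e (by rw [he]; push_cast; omega) hx, ?_⟩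
      rw [he, pow_add, Module.End.mul_apply, LinearMap.id_apply])

/-- The map `_sH_l(M) → _tH_{l-r}(M)`, `[m] ↦ [d^r m]`, where `s = t + r`.
For `r = 1` this is `d_*`; in general it is `(d_*)^r`. -/
def dMap (M : PDGModule.{u, v} p n k) (r s t : ℕ) (hs : s = t + r) (hsp : s ≤ p) (l l' : ℤ)
    (hl : l' = l - r) : M.H s l →ₗ[k] M.H t l' :=
  mapH ((M.d ^ r).restrictScalars k) s t l l'
    (fun m hm => by
      obtain ⟨h1, h2⟩ := mem_cycles.1 hm
      refine mem_cycles.2 ⟨M.d_pow_mem r hl h1, ?_⟩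
      rw [LinearMap.restrictScalars_apply, ← Module.End.mul_apply, ← pow_add, ← hs, h2])
    (fun m hm => by
      obtain ⟨x, hx, rfl⟩ := mem_boundaries.1 hm
      have e : p - t = r + (p - s) := by omega
      refine mem_boundaries.2 ⟨x, ?_, ?_⟩
      · have : l' + ((p - t : ℕ) : ℤ) = l + ((p - s : ℕ) : ℤ) := by
          rw [e, hl]; push_cast; omega
        rwa [this]
      · rw [e, pow_add, Module.End.mul_apply, LinearMap.restrictScalars_apply])

/-! ### Sub- and quotient modules -/

/-- A `p`-DG submodule: an `A`-submodule that is homogeneous (spanned by its homogeneous elements)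
and stable under the differential. -/
structure Sub (M : PDGModule.{u, v} p n k) where
  toSubmodule : Submodule (MvPolynomial (Fin n) k) M.carrier
  homogeneous : ∀ m ∈ toSubmodule, m ∈ ⨆ l : ℤ, (toSubmodule.restrictScalars k ⊓ M.gr l)
  d_mem : ∀ m ∈ toSubmodule, M.d m ∈ toSubmodule

theorem gr_iSupIndep (M : PDGModule.{u, v} p n k) : iSupIndep M.gr :=
  M.isInternal.submodule_iSupIndep

theorem gr_iSup (M : PDGModule.{u, v} p n k) : ⨆ l, M.gr l = ⊤ :=
  M.isInternal.submodule_iSup_eq_top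

namespace Sub

variable {M : PDGModule.{u, v} p n k}

theorem mem_of_sum_mem (Q : Sub M) (s : Finset ℤ) (w : ℤ → M.carrier)
    (hw : ∀ i ∈ s, w i ∈ M.gr i) (h : ∑ i ∈ s, w i ∈ Q.toSubmodule) :
    ∀ i ∈ s, w i ∈ Q.toSubmodule := by
  classical
  intro i hi
  obtain ⟨f, hf, hsum⟩ := (Submodule.mem_iSup_iff_exists_finsupp _ _).1 (Q.homogeneous _ h)
  have key := (iSupIndep_iff_finsetSum_eq_imp_eq _).1 M.gr_iSupIndep (s ∪ f.support)
    (fun i => if i ∈ s then w i else 0) (fun i => f i)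
    (fun j _ => ⟨by
      split_ifs with hj
      · exact hw j hj
      · exact Submodule.zero_mem _, (hf j).2⟩)
    (by
      rw [← Finset.sum_filter, Finset.filter_mem_eq_inter,
        Finset.inter_eq_right.2 Finset.subset_union_left, ← hsum]
      exact Finset.sum_subset Finset.subset_union_right (by simp))
    i (Finset.mem_union_left _ hi)
  simp only [hi, if_true] at key
  rw [key]
  exact (hf i).1

/-- A `p`-DG submodule as a `p`-DG module. -/
def toPDG (P : Sub M) : PDGModule.{u, v} p n k where
  carrier := P.toSubmodule
  gr l := (M.gr l).comap (P.toSubmodule.subtype.restrictScalars k)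
  isInternal := by
    rw [DirectSum.isInternal_submodule_iff_iSupIndep_and_iSup_eq_top]
    constructor
    · rw [iSupIndep_iff_finsetSum_eq_zero_imp_eq_zero]
      intro s v hv h0 i hi
      have := (iSupIndep_iff_finsetSum_eq_zero_imp_eq_zero _).1 M.gr_iSupIndep s
        (fun i => (v i : M.carrier)) hv (by simpa using congrArg Subtype.val h0) i hi
      exact Subtype.ext this
    · rw [eq_top_iff]
      rintro ⟨m, hm⟩ -
      have key : ∀ m ∈ ⨆ l : ℤ, (P.toSubmodule.restrictScalars k ⊓ M.gr l),
          ∃ hm : m ∈ P.toSubmodule, (⟨m, hm⟩ : P.toSubmodule) ∈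
            ⨆ l, (M.gr l).comap (P.toSubmodule.subtype.restrictScalars k) := by
        intro m hm
        induction hm using Submodule.iSup_induction' with
        | mem i x hx => exact ⟨hx.1, Submodule.mem_iSup_of_mem i hx.2⟩
        | zero => exact ⟨P.toSubmodule.zero_mem, Submodule.zero_mem _⟩
        | add x y _ _ hx hy =>
          obtain ⟨hx1, hx2⟩ := hx
          obtain ⟨hy1, hy2⟩ := hy
          exact ⟨P.toSubmodule.add_mem hx1 hy1, Submodule.add_mem _ hx2 hy2⟩
      exact (key m (P.homogeneous m hm)).2
  X_smul_mem i l m hm := M.X_smul_mem i l m hm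
  d := M.d.restrict P.d_mem
  d_mem l m hm := M.d_mem l m hm
  d_pow := by
    ext m
    have h := congrArg (fun f => f (m : M.carrier)) M.d_pow
    rw [Module.End.pow_restrict]
    simpa using h

/-- The quotient of a `p`-DG module by a `p`-DG submodule. -/
def quot (Q : Sub M) : PDGModule.{u, v} p n k where
  carrier := M.carrier ⧸ Q.toSubmodule
  gr l := (M.gr l).map (Q.toSubmodule.mkQ.restrictScalars k)
  isInternal := by
    rw [DirectSum.isInternal_submodule_iff_iSupIndep_and_iSup_eq_top]
    constructor
    · rw [iSupIndep_iff_finsetSum_eq_zero_imp_eq_zero]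
      intro s v hv h0 i hi
      have hv' : ∀ i ∈ s, ∃ m ∈ M.gr i, Q.toSubmodule.mkQ m = v i := hv
      choose! w hw hwv using hv'
      rw [← hwv i hi]
      refine (Submodule.Quotient.mk_eq_zero _).2 (Q.mem_of_sum_mem s w hw ?_ i hi)
      rw [← Submodule.Quotient.mk_eq_zero, ← h0, ← Submodule.mkQ_apply, map_sum]
      exact Finset.sum_congr rfl hwv
    · rw [← Submodule.map_iSup, M.gr_iSup, Submodule.map_top, LinearMap.range_eq_top]
      exact Q.toSubmodule.mkQ_surjective
  X_smul_mem i l m hm := by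
    obtain ⟨x, hx, rfl⟩ := hm
    exact ⟨_, M.X_smul_mem i l x hx, rfl⟩
  d := Q.toSubmodule.mapQ Q.toSubmodule M.d Q.d_mem
  d_mem l m hm := by
    obtain ⟨x, hx, rfl⟩ := hm
    exact ⟨_, M.d_mem l x hx, rfl⟩
  d_pow := by
    ext m
    have h := congrArg (fun f => f m) M.d_pow
    have h2 := Submodule.mapQ_pow (p := Q.toSubmodule) (f := M.d) Q.d_mem p
    simp only [LinearMap.zero_apply] at h
    rw [← h2]
    simp [h]

/-- The inclusion `P → M`. -/
def incl (P : Sub M) : P.toPDG.carrier →ₗ[MvPolynomial (Fin n) k] M.carrier :=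
  P.toSubmodule.subtype

/-- The projection `M → M / Q`. -/
def proj (Q : Sub M) : M.carrier →ₗ[MvPolynomial (Fin n) k] Q.quot.carrier :=
  Q.toSubmodule.mkQ

/-- For `p`-DG submodules `Q ≤ P` of `M`, the `p`-DG submodule `Q` of `P`. -/
def restrict (P Q : Sub M) (h : Q.toSubmodule ≤ P.toSubmodule) : Sub P.toPDG where
  toSubmodule := Q.toSubmodule.comap P.incl
  homogeneous := by
    intro m hm
    have key : ∀ m ∈ ⨆ l : ℤ, (Q.toSubmodule.restrictScalars k ⊓ M.gr l),
        ∃ m' : P.toPDG.carrier, P.incl m' = m ∧ m' ∈ ⨆ l : ℤ,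
          ((Q.toSubmodule.comap P.incl).restrictScalars k ⊓ P.toPDG.gr l) := by
      intro m hm
      refine Submodule.iSup_induction _ (motive := fun m => ∃ m' : P.toPDG.carrier,
        P.incl m' = m ∧ m' ∈ ⨆ l : ℤ,
          ((Q.toSubmodule.comap P.incl).restrictScalars k ⊓ P.toPDG.gr l)) hm ?_ ?_ ?_
      · intro i x hx
        exact ⟨⟨x, h hx.1⟩, rfl, Submodule.mem_iSup_of_mem i (Submodule.mem_inf.2 ⟨hx.1, hx.2⟩)⟩
      · exact ⟨0, map_zero _, Submodule.zero_mem _⟩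
      · rintro x y ⟨x', rfl, hx⟩ ⟨y', rfl, hy⟩
        exact ⟨x' + y', map_add _ _ _, Submodule.add_mem _ hx hy⟩
    obtain ⟨m', h1, h2⟩ := key _ (Q.homogeneous _ hm)
    rwa [Subtype.ext h1] at h2
  d_mem m hm := Q.d_mem (P.incl m) hm

theorem incl_d_pow (P : Sub M) (s : ℕ) (m : P.toPDG.carrier) :
    P.incl ((P.toPDG.d ^ s) m) = (M.d ^ s) (P.incl m) := by
  induction s generalizing m with
  | zero => rfl
  | succ s ih =>
    rw [pow_succ, pow_succ, Module.End.mul_apply, Module.End.mul_apply, ih]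
    rfl

theorem proj_d_pow (Q : Sub M) (s : ℕ) (m : M.carrier) :
    Q.proj ((M.d ^ s) m) = (Q.quot.d ^ s) (Q.proj m) := by
  induction s generalizing m with
  | zero => rfl
  | succ s ih =>
    rw [pow_succ, pow_succ, Module.End.mul_apply, Module.End.mul_apply, ih]
    rfl

theorem proj_eq_zero (Q : Sub M) {m : M.carrier} : Q.proj m = 0 ↔ m ∈ Q.toSubmodule :=
  Submodule.Quotient.mk_eq_zero _

theorem proj_mem_gr (Q : Sub M) {l : ℤ} {m : M.carrier} (hm : m ∈ M.gr l) :
    Q.proj m ∈ Q.quot.gr l := 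
  Submodule.mem_map_of_mem (f := Q.toSubmodule.mkQ.restrictScalars k) hm

theorem exists_of_mem_gr_quot (Q : Sub M) {l : ℤ} {x : Q.quot.carrier} (hx : x ∈ Q.quot.gr l) :
    ∃ m ∈ M.gr l, Q.proj m = x := hx

end Sub

/-! ### Composition series -/

/-- `M` is a direct sum of shifts of `A v ⊕ A dv ⊕ ⋯ ⊕ A d^{j-1} v` (with `d^j v = 0`): there are
homogeneous elements `v_i` with `d^j v_i = 0` such that the elements `d^a v_i`, `0 ≤ a < j`, form an
`A`-basis. For `j = 1` this is a direct sum of shifts of `A` (with zero differential). -/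
def IsSumOfStrings (M : PDGModule.{u, v} p n k) (j : ℕ) : Prop :=
  ∃ (ι : Type v) (x : ι → M.carrier) (c : ι → ℤ),
    (∀ i, x i ∈ M.gr (c i)) ∧ (∀ i, (M.d ^ j) (x i) = 0) ∧
    ∃ b : Module.Basis (ι × Fin j) (MvPolynomial (Fin n) k) M.carrier,
      ∀ i (a : Fin j), b (i, a) = (M.d ^ (a : ℕ)) (x i)

/-- `M` has a composition series of length `r`: a filtration `0 = F 0 ⊂ F 1 ⊂ ⋯ ⊂ F r = M` by
`p`-DG submodules with strict inclusions, such that each quotient `F (i+1) / F i` is a direct sum of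
shifts of `A`, or a direct sum of shifts of `A v ⊕ A dv ⊕ ⋯ ⊕ A d^{p-2} v`. -/
def HasCompositionSeries (M : PDGModule.{u, v} p n k) (r : ℕ) : Prop :=
  ∃ F : ℕ → Sub M, (F 0).toSubmodule = ⊥ ∧ (F r).toSubmodule = ⊤ ∧
    ∀ i < r, ∃ h : (F i).toSubmodule < (F (i + 1)).toSubmodule,
      ((F (i + 1)).restrict (F i) h.le).quot.IsSumOfStrings 1 ∨
      ((F (i + 1)).restrict (F i) h.le).quot.IsSumOfStrings (p - 1)

/-! ### The filtration by powers of the augmentation ideal -/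

/-- The ideal `I = (x_1, …, x_n)` of `A`. -/
def augIdeal (n : ℕ) (k : Type u) [Field k] : Ideal (MvPolynomial (Fin n) k) :=
  Ideal.span (Set.range MvPolynomial.X)

theorem X_mem_augIdeal (i : Fin n) : (MvPolynomial.X i : MvPolynomial (Fin n) k) ∈ augIdeal n k :=
  Ideal.subset_span ⟨i, rfl⟩

theorem smul_mem_of_mem_augIdeal (M : PDGModule.{u, v} p n k) (S : Submodule k M.carrier)
    (hS : ∀ (i : Fin n) (l : ℤ), ∀ y ∈ M.gr l, (MvPolynomial.X i : MvPolynomial (Fin n) k) • y ∈ S)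
    (a : MvPolynomial (Fin n) k) (ha : a ∈ augIdeal n k) (y : M.carrier) : a • y ∈ S := by
  have hX : ∀ (i : Fin n) (y : M.carrier), (MvPolynomial.X i : MvPolynomial (Fin n) k) • y ∈ S := by
    intro i y
    have hy : y ∈ ⨆ l, M.gr l := by rw [M.gr_iSup]; trivial
    refine Submodule.iSup_induction _ (motive := fun y =>
      (MvPolynomial.X i : MvPolynomial (Fin n) k) • y ∈ S) hy (hS i) ?_ ?_
    · rw [smul_zero]; exact S.zero_mem
    · intro y z hy hz
      rw [smul_add]; exact S.add_mem hy hz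
  refine Submodule.span_induction (p := fun a _ => ∀ y : M.carrier, a • y ∈ S)
    ?_ ?_ ?_ ?_ ha y
  · rintro _ ⟨i, rfl⟩; exact hX i
  · intro y; rw [zero_smul]; exact S.zero_mem
  · intro x y _ _ hx hy z; rw [add_smul]; exact S.add_mem (hx z) (hy z)
  · intro a x _ hx y; rw [smul_eq_mul, mul_comm, mul_smul]; exact hx _

/-- The `A`-submodule `IM` of `M`. -/
def augSubmodule (M : PDGModule.{u, v} p n k) : Submodule (MvPolynomial (Fin n) k) M.carrier :=
  augIdeal n k • ⊤

theorem smul_mem_augSubmodule (M : PDGModule.{u, v} p n k) {a : MvPolynomial (Fin n) k}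
    (ha : a ∈ augIdeal n k) (y : M.carrier) : a • y ∈ M.augSubmodule :=
  Submodule.smul_mem_smul ha Submodule.mem_top

theorem augSubmodule_induction (M : PDGModule.{u, v} p n k) {P : M.carrier → Prop}
    (h1 : ∀ a ∈ augIdeal n k, ∀ y, P (a • y)) (h2 : ∀ x y, P x → P y → P (x + y))
    (m : M.carrier) (hm : m ∈ M.augSubmodule) : P m :=
  Submodule.smul_induction_on hm (fun a ha y _ => h1 a ha y) h2

/-- The `p`-DG submodule `IM` of `M`. -/
def augSub (M : PDGModule.{u, v} p n k) : Sub M where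
  toSubmodule := M.augSubmodule
  homogeneous := M.augSubmodule_induction
    (M.smul_mem_of_mem_augIdeal _ fun i l y hy => Submodule.mem_iSup_of_mem (l - 1)
      (Submodule.mem_inf.2
        ⟨M.smul_mem_augSubmodule (X_mem_augIdeal i) y, M.X_smul_mem i l y hy⟩))
    (fun _ _ hx hy => Submodule.add_mem _ hx hy)
  d_mem := M.augSubmodule_induction
    (fun a ha y => by rw [map_smul]; exact M.smul_mem_augSubmodule ha _)
    (fun x y hx hy => by rw [map_add]; exact Submodule.add_mem _ hx hy)

/-- The `p`-DG module `M ⊗_A k = M / IM`. -/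
def fiber (M : PDGModule.{u, v} p n k) : PDGModule.{u, v} p n k := M.augSub.quot

/-- The `p`-DG module `IM / I²M = IM / I(IM)`. -/
def fiberOne (M : PDGModule.{u, v} p n k) : PDGModule.{u, v} p n k := M.augSub.toPDG.fiber

/-- The class `[m + IM]` in `_sH_l(M/IM)`, for `m ∈ M_l` with `d^s m ∈ IM`. Every class in
`_sH_l(M/IM)` is of this form. -/
def fiberClass (M : PDGModule.{u, v} p n k) (s : ℕ) (l : ℤ) (m : M.carrier) (hm : m ∈ M.gr l)
    (hd : (M.d ^ s) m ∈ M.augSub.toSubmodule) : M.fiber.H s l :=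
  M.fiber.homClass s l (M.augSub.proj m)
    (mem_cycles.2 ⟨M.augSub.proj_mem_gr hm,
      (M.augSub.proj_d_pow s m).symm.trans (M.augSub.proj_eq_zero.2 hd)⟩)

theorem exists_fiberClass (M : PDGModule.{u, v} p n k) (s : ℕ) (l : ℤ) (ξ : M.fiber.H s l) :
    ∃ (m : M.carrier) (hm : m ∈ M.gr l) (hd : (M.d ^ s) m ∈ M.augSub.toSubmodule),
      ξ = M.fiberClass s l m hm hd := by
  obtain ⟨⟨x, hx⟩, rfl⟩ := Submodule.Quotient.mk_surjective _ ξ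
  obtain ⟨h1, h2⟩ := mem_cycles.1 hx
  obtain ⟨m, hm, rfl⟩ := M.augSub.exists_of_mem_gr_quot h1
  exact ⟨m, hm, M.augSub.proj_eq_zero.1 ((M.augSub.proj_d_pow s m).trans h2), rfl⟩

/-- The class `[d^s m + I²M]` in `_tH_{l'}(IM/I²M)`, for `m ∈ M_l` with `d^s m ∈ IM`, where
`t = p - s` and `l' = l - s`. This is the value `d¹[m + IM]` of the differential
`d¹ : _sH_l(M/IM) → _{p-s}H_{l-s}(IM/I²M)` on the `E¹`-page of the spectral sequence of the
filtration `(I^i M)_i`. -/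
def dOneClass (M : PDGModule.{u, v} p n k) (s t : ℕ) (hst : t + s = p) (l l' : ℤ)
    (hl : l' = l - s) (m : M.carrier) (hm : m ∈ M.gr l)
    (hd : (M.d ^ s) m ∈ M.augSub.toSubmodule) : M.fiberOne.H t l' :=
  M.augSub.toPDG.fiberClass t l' ⟨(M.d ^ s) m, hd⟩ (M.d_pow_mem s hl hm) (by
    have h0 : (M.augSub.toPDG.d ^ t) ⟨(M.d ^ s) m, hd⟩ = 0 := by
      refine Subtype.ext ((M.augSub.incl_d_pow t ⟨(M.d ^ s) m, hd⟩).trans ?_)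
      change (M.d ^ t) ((M.d ^ s) m) = 0
      rw [← Module.End.mul_apply, ← pow_add, hst, M.d_pow]
      rfl
    rw [h0]
    exact Submodule.zero_mem _)

/-- Multiplication by `x_i` as a map `M → IM`. -/
def xSub (M : PDGModule.{u, v} p n k) (i : Fin n) :
    M.carrier →ₗ[MvPolynomial (Fin n) k] M.augSub.toPDG.carrier :=
  (LinearMap.lsmul (MvPolynomial (Fin n) k) M.carrier (MvPolynomial.X i)).codRestrict
    M.augSub.toSubmodule fun y => M.smul_mem_augSubmodule (X_mem_augIdeal i) y

theorem incl_xSub (M : PDGModule.{u, v} p n k) (i : Fin n) (m : M.carrier) :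
    M.augSub.incl (M.xSub i m) = (MvPolynomial.X i : MvPolynomial (Fin n) k) • m := rfl

theorem xSub_mem_gr (M : PDGModule.{u, v} p n k) (i : Fin n) {l : ℤ} {m : M.carrier}
    (hm : m ∈ M.gr l) : M.xSub i m ∈ M.augSub.toPDG.gr (l - 1) := M.X_smul_mem i l m hm

theorem d_pow_xSub (M : PDGModule.{u, v} p n k) (i : Fin n) (s : ℕ) (m : M.carrier) :
    (M.augSub.toPDG.d ^ s) (M.xSub i m) = M.xSub i ((M.d ^ s) m) :=
  Subtype.ext ((M.augSub.incl_d_pow s _).trans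
    ((congrArg _ (M.incl_xSub i m)).trans (map_smul _ _ _)))

/-- Multiplication by `x_i` as a map `M/IM → IM/I²M`, `m + IM ↦ x_i m + I²M`. -/
def xFiber (M : PDGModule.{u, v} p n k) (i : Fin n) :
    M.fiber.carrier →ₗ[MvPolynomial (Fin n) k] M.fiberOne.carrier :=
  Submodule.mapQ M.augSub.toSubmodule M.augSub.toPDG.augSub.toSubmodule (M.xSub i)
    (M.augSubmodule_induction
      (fun a ha y => by
        rw [Submodule.mem_comap, map_smul]
        exact M.augSub.toPDG.smul_mem_augSubmodule ha _)
      (fun x y hx hy => Submodule.add_mem _ hx hy))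

theorem xFiber_proj (M : PDGModule.{u, v} p n k) (i : Fin n) (m : M.carrier) :
    M.xFiber i (M.augSub.proj m) = M.augSub.toPDG.augSub.proj (M.xSub i m) := rfl

theorem d_pow_xFiber (M : PDGModule.{u, v} p n k) (i : Fin n) (s : ℕ) (m : M.fiber.carrier) :
    (M.fiberOne.d ^ s) (M.xFiber i m) = M.xFiber i ((M.fiber.d ^ s) m) := by
  obtain ⟨m, rfl⟩ := M.augSub.toSubmodule.mkQ_surjective m
  refine (M.augSub.toPDG.augSub.proj_d_pow s (M.xSub i m)).symm.trans ?_
  rw [d_pow_xSub, ← xFiber_proj, M.augSub.proj_d_pow]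
  rfl

theorem xFiber_mem_gr (M : PDGModule.{u, v} p n k) (i : Fin n) {l : ℤ} {m : M.fiber.carrier}
    (hm : m ∈ M.fiber.gr l) : M.xFiber i m ∈ M.fiberOne.gr (l - 1) := by
  obtain ⟨y, hy, rfl⟩ := M.augSub.exists_of_mem_gr_quot hm
  exact M.augSub.toPDG.augSub.proj_mem_gr (M.xSub_mem_gr i hy)

/-- The map `_sH_l(M/IM) → _sH_{l-1}(IM/I²M)`, `[m + IM] ↦ [x_i m + I²M]`. Under the isomorphism
`I/I² ⊗_A _sH_l(M/IM) ≅ _sH_{l-1}(IM/I²M)`, `[f] ⊗ [m] ↦ [f m]`, it is `ξ ↦ x_i ⊗ ξ`. -/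
def xMap (M : PDGModule.{u, v} p n k) (i : Fin n) (s : ℕ) (l l' : ℤ) (hl : l' = l - 1) :
    M.fiber.H s l →ₗ[k] M.fiberOne.H s l' :=
  mapH ((M.xFiber i).restrictScalars k) s s l l'
    (fun m hm => by
      obtain ⟨h1, h2⟩ := mem_cycles.1 hm
      subst hl
      refine mem_cycles.2 ⟨M.xFiber_mem_gr i h1, ?_⟩
      rw [LinearMap.restrictScalars_apply, d_pow_xFiber, h2, map_zero])
    (fun m hm => by
      obtain ⟨y, hy, rfl⟩ := mem_boundaries.1 hm
      refine mem_boundaries.2 ⟨M.xFiber i y, ?_, M.d_pow_xFiber i _ y⟩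
      have : l' + ((p - s : ℕ) : ℤ) = l + ((p - s : ℕ) : ℤ) - 1 := by omega
      rw [this]
      exact M.xFiber_mem_gr i hy)

end

end PDGModule

/-! ### The group algebra `k[G]`, `G = (ℤ/p)^n`, and Loewy lengths -/

/-- The group algebra `k[G]` of the elementary abelian group `G = (ℤ/p)^n`. -/
abbrev GroupAlg (p n : ℕ) (k : Type u) [Field k] : Type u :=
  MonoidAlgebra k (Multiplicative (Fin n → ZMod p))

/-- The element `y_i = e_i - 1` of `k[G]`. -/
def yElt (p n : ℕ) (k : Type u) [Field k] (i : Fin n) : GroupAlg p n k :=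
  MonoidAlgebra.of k (Multiplicative (Fin n → ZMod p)) (Multiplicative.ofAdd (Pi.single i 1)) - 1

/-- The augmentation ideal `J = (y_1, …, y_n)` of `k[G]`. -/
def groupAugIdeal (p n : ℕ) (k : Type u) [Field k] : Ideal (GroupAlg p n k) :=
  Ideal.span (Set.range (yElt p n k))

/-- The Loewy length `inf {r ≥ 0 | J^r V = 0}` of a `k[G]`-module `V`. (If `k` has characteristic
`p`, then `J` is nilpotent and the set is non-empty.) -/
def loewyLength (p n : ℕ) (k : Type u) [Field k] (V : Type v) [AddCommGroup V]
    [Module (GroupAlg p n k) V] : ℕ :=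
  sInf {r : ℕ | groupAugIdeal p n k ^ r • (⊤ : Submodule (GroupAlg p n k) V) = ⊥}

namespace PDGModule

/-- Given `k`-linear `k[G]`-actions on all the homology groups `_sH_l(M/IM)`, the conditions that
* `i_* : _sH_l → _{s+1}H_l`, `1 ≤ s ≤ p-2`, are isomorphisms for `l ≡ p-1 mod p`;
* `d_* : _{s+1}H_{l-(p-2-s)} → _sH_{l-(p-2-s)-1}`, `1 ≤ s ≤ p-2`, are isomorphisms for
  `l ≡ p-2 mod p`;
* all `i_*` and `d_*` are equivariant;
* `d¹ : _1H_l → I/I² ⊗ _{p-1}H_l ≅ I/I² ⊗ _1H_l` is `ξ ↦ ∑ x_i ⊗ y_i ξ` for `l ≡ p-1 mod p`;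
* `d¹ : _{p-1}H_l → I/I² ⊗ _1H_{l-p+2} ≅ I/I² ⊗ _{p-1}H_l` is `ξ ↦ ∑ x_i ⊗ (p-1) y_i ξ` for
  `l ≡ p-2 mod p`.
The last two are identities in `_{p-1}H_{l-1}(IM/I²M)` and `_1H_{l-p+1}(IM/I²M)`, which are
identified with the tensor products via `[f] ⊗ [m] ↦ [f m]`. -/
structure CompatibleAction {p n : ℕ} [hp : Fact p.Prime] {k : Type u} [Field k]
    (M : PDGModule.{u, v} p n k)
    [∀ (s : ℕ) (l : ℤ), Module (GroupAlg p n k) (M.fiber.H s l)]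
    [∀ (s : ℕ) (l : ℤ), IsScalarTower k (GroupAlg p n k) (M.fiber.H s l)] : Prop where
  i_bijective : ∀ l : ℤ, l ≡ p - 1 [ZMOD p] → ∀ s : ℕ, 1 ≤ s → s + 1 ≤ p - 1 →
    Function.Bijective (M.fiber.iMap s (s + 1) s.le_succ l)
  d_bijective : ∀ l : ℤ, l ≡ p - 2 [ZMOD p] → ∀ s : ℕ, 1 ≤ s → ∀ hs : s + 1 ≤ p - 1,
    Function.Bijective (M.fiber.dMap 1 (s + 1) s rfl (hs.trans (p.sub_le 1))
      (l - (p - 2 - s)) (l - (p - 2 - s) - (1 : ℕ)) rfl)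
  i_equivariant : ∀ (l : ℤ) (s : ℕ), 1 ≤ s → s + 1 ≤ p - 1 →
    ∀ (a : GroupAlg p n k) (ξ : M.fiber.H s l),
      M.fiber.iMap s (s + 1) s.le_succ l (a • ξ) = a • M.fiber.iMap s (s + 1) s.le_succ l ξ
  d_equivariant : ∀ (l : ℤ) (s : ℕ), 1 ≤ s → ∀ hs : s + 1 ≤ p - 1,
    ∀ (a : GroupAlg p n k) (ξ : M.fiber.H (s + 1) l),
      M.fiber.dMap 1 (s + 1) s rfl (hs.trans (p.sub_le 1)) l (l - (1 : ℕ)) rfl (a • ξ) =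
        a • M.fiber.dMap 1 (s + 1) s rfl (hs.trans (p.sub_le 1)) l (l - (1 : ℕ)) rfl ξ
  dOne_of_neg_one : ∀ l : ℤ, l ≡ p - 1 [ZMOD p] →
    ∀ (m : M.carrier) (hm : m ∈ M.gr l) (hd : (M.d ^ 1) m ∈ M.augSub.toSubmodule),
      M.dOneClass 1 (p - 1) (Nat.sub_add_cancel hp.out.one_le) l (l - (1 : ℕ)) rfl m hm hd =
        ∑ i : Fin n, M.xMap i (p - 1) l (l - (1 : ℕ)) rfl
          (M.fiber.iMap 1 (p - 1) (Nat.le_sub_one_of_lt hp.out.one_lt) l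
            (yElt p n k i • M.fiberClass 1 l m hm hd))
  dOne_of_neg_two : ∀ l : ℤ, l ≡ p - 2 [ZMOD p] →
    ∀ (m : M.carrier) (hm : m ∈ M.gr l) (hd : (M.d ^ (p - 1)) m ∈ M.augSub.toSubmodule),
      M.dOneClass (p - 1) 1 (Nat.add_sub_cancel' hp.out.one_le) l (l - (p - 1 : ℕ)) rfl m hm hd =
        ∑ i : Fin n, M.xMap i 1 (l - (p - 2 : ℕ)) (l - (p - 1 : ℕ))
          (by have := hp.out.two_le; omega)
          (M.fiber.dMap (p - 2) (p - 1) 1 (by have := hp.out.two_le; omega) (p.sub_le 1)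
            l (l - (p - 2 : ℕ)) rfl
            ((((p : k) - 1) • yElt p n k i) • M.fiberClass (p - 1) l m hm hd))

end PDGModule

end

/-! The fiber `W = M/IM` is a `p`-complex over `k`, hence a sum of strings `v, dv, …, d^{j-1}v`. The
assumptions on `i_*` and `d_*` allow, besides strings of length `p`, only strings of length `p-1`
ending in degrees divisible by `p` and strings of length `1` in degrees congruent to `-1`; the last
elements of these represent a basis of the groups `_1H_l`
(`HasBijectiveMaps.linearIndependent_and_span_strings`). By the graded Nakayama lemma, lifts of the
strings form an `A`-basis of `M` (`exists_basis_of_fiber`); for a lifted string of length `j`, `d^j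
v` is only known to lie in `IM`. Strings of length `p` are contractible and split off
(`exists_splitting`), which leaves `N`, homotopy equivalent to `M`, with a basis of the remaining
strings.

It remains to make the differential of `N` triangular. In each `_1H_l` take a basis adapted to the
Loewy filtration `J^r _1H_l`, and lift it by a `k`-linear section. The description of `d¹` says that
`d` carries the last element of the string of `ξ` to a multiple of the sum of `x_i` times the last
elements for `y_i ξ`, up to `d^j(IN)` and `I²N`; and `y_i ξ` lies one Loewy layer deeper. Since `A`
lives in nonpositive degrees, the two error terms involve only strings ending in higher degrees and
non-last elements of strings ending in the same degree. The non-last elements occur only for length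
`p-1`, where `d^p = 0` and an induction on the rank show that their strings have higher rank too
(`d_pow_top_mem_span_rank`).

So `d` maps the last element of a string into strings with a lexicographically larger pair (last
degree, Loewy rank). Adding the strings pair by pair, from the largest pair down, gives a
composition series. The Loewy filtration of `_1H_l` decreases strictly until it vanishes, so the
pairs over `l` number exactly the Loewy length of `_1H_l`. -/

namespace PDGModule

section

variable {p n : ℕ} {k : Type u} [Field k]

/-! ### Homogeneous components -/

/-- The projection of `M` onto its component of degree `l`. -/
noncomputable def component (M : PDGModule.{u, v} p n k) (l : ℤ) : M.carrier →ₗ[k] M.carrier :=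
  letI := M.isInternal.chooseDecomposition
  (M.gr l).subtype ∘ₗ DirectSum.component k ℤ (fun i => M.gr i) l ∘ₗ
    (DirectSum.decomposeLinearEquiv M.gr).toLinearMap

theorem component_mem (M : PDGModule.{u, v} p n k) (l : ℤ) (m : M.carrier) :
    M.component l m ∈ M.gr l := by
  simp [component]

theorem component_of_mem (M : PDGModule.{u, v} p n k) {l : ℤ} {m : M.carrier} (hm : m ∈ M.gr l) :
    M.component l m = m := by
  let := M.isInternal.chooseDecomposition
  exact DirectSum.decompose_of_mem_same M.gr hm

theorem component_of_mem_ne (M : PDGModule.{u, v} p n k) {l l' : ℤ} {m : M.carrier}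
    (hm : m ∈ M.gr l') (h : l' ≠ l) : M.component l m = 0 := by
  let := M.isInternal.chooseDecomposition
  exact DirectSum.decompose_of_mem_ne M.gr hm h

/-- To prove an additive statement for all elements it suffices to prove it for the homogeneous
ones. -/
theorem homogeneous_induction (M : PDGModule.{u, v} p n k) {P : M.carrier → Prop}
    (h : ∀ l, ∀ m ∈ M.gr l, P m) (hadd : ∀ x y, P x → P y → P (x + y)) (m : M.carrier) : P m := by
  have hm : m ∈ ⨆ l, M.gr l := by rw [M.gr_iSup]; trivial
  exact Submodule.iSup_induction _ (motive := P) hm h (h 0 0 (Submodule.zero_mem _)) hadd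

theorem mem_of_component_mem (M : PDGModule.{u, v} p n k) (S : Submodule k M.carrier)
    {m : M.carrier} (h : ∀ l, M.component l m ∈ S) : m ∈ S := by
  classical
  let := M.isInternal.chooseDecomposition
  rw [← DirectSum.sum_support_decompose M.gr m]
  exact S.sum_mem fun l _ => h l

theorem component_X_smul (M : PDGModule.{u, v} p n k) (i : Fin n) (l : ℤ) (m : M.carrier) :
    M.component l ((MvPolynomial.X i : MvPolynomial (Fin n) k) • m) =
      (MvPolynomial.X i : MvPolynomial (Fin n) k) • M.component (l + 1) m := by
  induction m using M.homogeneous_induction with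
  | h l' m hm =>
    have h1 := M.X_smul_mem i l' m hm
    by_cases h : l' = l + 1
    · subst h
      rw [M.component_of_mem hm, M.component_of_mem (by simpa using h1)]
    · rw [M.component_of_mem_ne hm h, M.component_of_mem_ne h1 (by omega), smul_zero]
  | hadd x y hx hy => rw [smul_add, map_add, hx, hy, map_add, smul_add]

theorem C_smul (M : PDGModule.{u, v} p n k) (a : k) (m : M.carrier) :
    (MvPolynomial.C a : MvPolynomial (Fin n) k) • m = a • m := by
  rw [← MvPolynomial.algebraMap_eq, algebraMap_smul]

/-- An `A`-submodule is homogeneous if it contains the components of its elements. -/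
def IsHomog (M : PDGModule.{u, v} p n k) (S : Submodule (MvPolynomial (Fin n) k) M.carrier) : Prop :=
  ∀ m ∈ S, ∀ l, M.component l m ∈ S

theorem IsHomog.mem_iSup {M : PDGModule.{u, v} p n k}
    {S : Submodule (MvPolynomial (Fin n) k) M.carrier} (hS : M.IsHomog S) {m : M.carrier}
    (hm : m ∈ S) : m ∈ ⨆ l : ℤ, (S.restrictScalars k ⊓ M.gr l) :=
  M.mem_of_component_mem _ fun l =>
    Submodule.mem_iSup_of_mem l (Submodule.mem_inf.2 ⟨hS m hm l, M.component_mem l m⟩)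

/-- `A` is concentrated in nonpositive degrees and generated by the variables: in the induction on
`f`, a variable is absorbed into `m` and lowers its degree `c` by one. -/
theorem component_smul_mem_span (M : PDGModule.{u, v} p n k) (f : MvPolynomial (Fin n) k) :
    ∀ (c l : ℤ) (m : M.carrier), m ∈ M.gr c →
      M.component l (f • m) ∈ Submodule.span (MvPolynomial (Fin n) k) {m} ∧
      (c < l → M.component l (f • m) = 0) := by
  induction f using MvPolynomial.induction_on with
  | C a =>
    intro c l m hm
    have h := (M.gr c).smul_mem a hm
    rw [C_smul]
    refine ⟨?_, fun hl => M.component_of_mem_ne h hl.ne⟩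
    by_cases hc : c = l
    · subst hc
      rw [M.component_of_mem h, ← C_smul]
      exact Submodule.smul_mem _ _ (Submodule.mem_span_singleton_self m)
    · rw [M.component_of_mem_ne h hc]
      exact Submodule.zero_mem _
  | add f g hf hg =>
    intro c l m hm
    rw [add_smul, map_add]
    refine ⟨Submodule.add_mem _ (hf c l m hm).1 (hg c l m hm).1, fun h => ?_⟩
    rw [(hf c l m hm).2 h, (hg c l m hm).2 h, add_zero]
  | mul_X f i hf =>
    intro c l m hm
    rw [mul_smul]
    obtain ⟨h1, h2⟩ := hf (c - 1) l _ (M.X_smul_mem i c m hm)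
    refine ⟨Submodule.span_le.2 ?_ h1, fun h => h2 (by omega)⟩
    rintro _ rfl
    exact Submodule.smul_mem _ _ (Submodule.mem_span_singleton_self m)

theorem isHomog_span (M : PDGModule.{u, v} p n k) {ι : Type w} {e : ι → M.carrier} {c : ι → ℤ}
    (he : ∀ i, e i ∈ M.gr (c i)) (s : Set ι) :
    M.IsHomog (Submodule.span (MvPolynomial (Fin n) k) (e '' s)) := by
  intro m hm l
  induction hm using Submodule.closure_induction with
  | zero => rw [map_zero]; exact Submodule.zero_mem _
  | add x y _ _ hx hy => rw [map_add]; exact Submodule.add_mem _ hx hy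
  | smul_mem a x hx =>
    obtain ⟨i, hi, rfl⟩ := hx
    exact Submodule.span_mono (Set.singleton_subset_iff.2 (Set.mem_image_of_mem e hi))
      (M.component_smul_mem_span a _ l _ (he i)).1

/-- The degree-`l` part of `I S` is generated by the products of the variables with the elements
of `S` of degree `l + 1`. -/
theorem component_mem_of_mem_augIdeal_smul (M : PDGModule.{u, v} p n k)
    {S T : Submodule (MvPolynomial (Fin n) k) M.carrier} (hS : M.IsHomog S) {l : ℤ}
    (h : ∀ i, ∀ s ∈ S, s ∈ M.gr (l + 1) → (MvPolynomial.X i : MvPolynomial (Fin n) k) • s ∈ T)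
    {m : M.carrier} (hm : m ∈ augIdeal n k • S) : M.component l m ∈ T := by
  induction hm using Submodule.smul_induction_on' with
  | add x _ y _ hx hy => rw [map_add]; exact T.add_mem hx hy
  | smul a ha s hs =>
    revert s
    refine Submodule.span_induction (p := fun a _ => ∀ s ∈ S, M.component l (a • s) ∈ T)
      ?_ ?_ ?_ ?_ ha
    · rintro _ ⟨i, rfl⟩ s hs
      rw [component_X_smul]
      exact h i _ (hS s hs _) (M.component_mem _ _)
    · intro s _; rw [zero_smul, map_zero]; exact T.zero_mem
    · intro a b _ _ ha hb s hs
      rw [add_smul, map_add]; exact T.add_mem (ha s hs) (hb s hs)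
    · intro b a _ ha s hs
      rw [smul_eq_mul, mul_comm, mul_smul]; exact ha _ (S.smul_mem b hs)

theorem isHomog_augIdeal_smul (M : PDGModule.{u, v} p n k)
    {S : Submodule (MvPolynomial (Fin n) k) M.carrier} (hS : M.IsHomog S) :
    M.IsHomog (augIdeal n k • S) := fun _ hm _ =>
  M.component_mem_of_mem_augIdeal_smul hS
    (fun i _ hs _ => Submodule.smul_mem_smul (X_mem_augIdeal i) hs) hm

theorem isHomog_top (M : PDGModule.{u, v} p n k) : M.IsHomog ⊤ := fun _ _ _ => trivial

/-! ### Degree estimates for homogeneous generators, and the graded Nakayama lemma -/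

section Generators

variable {M : PDGModule.{u, v} p n k} {ι : Type w} {e : ι → M.carrier} {c : ι → ℤ}

/-- Coefficients only lower degrees, so generators of degree below `l` cannot contribute in degree
`l`. This bound and its sharper forms for `IM` and `I²M` yield all later degree estimates for the
differential. -/
theorem mem_span_of_mem_gr (he : ∀ i, e i ∈ M.gr (c i))
    (hspan : Submodule.span (MvPolynomial (Fin n) k) (Set.range e) = ⊤) {l : ℤ} {m : M.carrier}
    (hm : m ∈ M.gr l) : m ∈ Submodule.span (MvPolynomial (Fin n) k) (e '' {i | l ≤ c i}) := by
  rw [← M.component_of_mem hm]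
  clear hm
  have hm : m ∈ Submodule.span (MvPolynomial (Fin n) k) (Set.range e) := hspan ▸ trivial
  induction hm using Submodule.closure_induction with
  | zero => rw [map_zero]; exact Submodule.zero_mem _
  | add x y _ _ hx hy => rw [map_add]; exact Submodule.add_mem _ hx hy
  | smul_mem a x hx =>
    obtain ⟨i, rfl⟩ := hx
    obtain ⟨h1, h2⟩ := M.component_smul_mem_span a _ l _ (he i)
    by_cases hl : l ≤ c i
    · exact Submodule.span_mono (Set.singleton_subset_iff.2 (Set.mem_image_of_mem e hl)) h1
    · rw [h2 (not_le.1 hl)]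
      exact Submodule.zero_mem _

theorem mem_span_of_mem_augIdeal_smul
    {S : Submodule (MvPolynomial (Fin n) k) M.carrier} (hS : M.IsHomog S) {q : ℤ}
    (h : ∀ l, ∀ s ∈ S, s ∈ M.gr l →
      s ∈ Submodule.span (MvPolynomial (Fin n) k) (e '' {i | l + q ≤ c i})) {l : ℤ} {m : M.carrier}
    (hm : m ∈ M.gr l) (hmS : m ∈ augIdeal n k • S) :
    m ∈ Submodule.span (MvPolynomial (Fin n) k) (e '' {i | l + (q + 1) ≤ c i}) := by
  rw [← M.component_of_mem hm]
  refine M.component_mem_of_mem_augIdeal_smul hS (fun i s hs hl => Submodule.smul_mem _ _ ?_) hmS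
  have := h (l + 1) s hs hl
  rwa [add_assoc, add_comm 1 q] at this

theorem mem_span_of_mem_augSubmodule (he : ∀ i, e i ∈ M.gr (c i))
    (hspan : Submodule.span (MvPolynomial (Fin n) k) (Set.range e) = ⊤) {l : ℤ} {m : M.carrier}
    (hm : m ∈ M.gr l) (hmI : m ∈ M.augSubmodule) :
    m ∈ Submodule.span (MvPolynomial (Fin n) k) (e '' {i | l + 1 ≤ c i}) := by
  have := mem_span_of_mem_augIdeal_smul (q := 0) M.isHomog_top
    (fun l s _ hl => by simpa using mem_span_of_mem_gr he hspan hl) hm hmI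
  simpa using this

theorem mem_span_of_mem_augIdeal_smul_augSubmodule (he : ∀ i, e i ∈ M.gr (c i))
    (hspan : Submodule.span (MvPolynomial (Fin n) k) (Set.range e) = ⊤) {l : ℤ} {m : M.carrier}
    (hm : m ∈ M.gr l) (hmI : m ∈ augIdeal n k • M.augSubmodule) :
    m ∈ Submodule.span (MvPolynomial (Fin n) k) (e '' {i | l + 2 ≤ c i}) :=
  mem_span_of_mem_augIdeal_smul (q := 1) (M.isHomog_augIdeal_smul M.isHomog_top)
    (fun _ _ hs hl => mem_span_of_mem_augSubmodule he hspan hl hs) hm hmI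

/-- Graded Nakayama lemma. -/
theorem span_eq_top_of_sup_augSubmodule (hbdd : ∃ L : ℤ, ∀ l, L < l → M.gr l = ⊥)
    {S : Submodule (MvPolynomial (Fin n) k) M.carrier} (hS : M.IsHomog S)
    (h : S ⊔ M.augSubmodule = ⊤) : S = ⊤ := by
  obtain ⟨L, hL⟩ := hbdd
  -- Descending induction on the degree, starting above the bound `L`: the part of `m` in `IM` is a
  -- sum of variables times elements of degree `l + 1`.
  have key : ∀ (j : ℕ) (l : ℤ), L < l + j → ∀ m ∈ M.gr l, m ∈ S := by
    intro j
    induction j with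
    | zero =>
      intro l hl m hm
      rw [hL l (by simpa using hl)] at hm
      rw [(Submodule.mem_bot k).1 hm]
      exact S.zero_mem
    | succ j ih =>
      intro l hl m hm
      obtain ⟨s, hs, t, ht, rfl⟩ := Submodule.mem_sup.1 (h ▸ Submodule.mem_top : m ∈ S ⊔ M.augSubmodule)
      rw [← M.component_of_mem hm, map_add]
      exact S.add_mem (hS s hs l) (M.component_mem_of_mem_augIdeal_smul M.isHomog_top
        (fun i y _ hy => S.smul_mem _ (ih (l + 1) (by push_cast at hl; omega) y hy)) ht)
  rw [eq_top_iff]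
  rintro m -
  induction m using M.homogeneous_induction with
  | h l m hm => exact key (L - l + 1).toNat l (by omega) m hm
  | hadd x y hx hy => exact S.add_mem hx hy

end Generators

end

end PDGModule

/-- In a space with a nilpotent operator, strings are linearly independent as soon as their last
elements are. -/
theorem linearIndependent_strings {K : Type u} {V : Type v} [Field K] [AddCommGroup V] [Module K V]
    (d : Module.End K V) {β : Type w} (len : β → ℕ) (e : β → V)
    (he : ∀ x, (d ^ len x) (e x) = 0)
    (hli : LinearIndependent K fun x => (d ^ (len x - 1)) (e x)) :
    LinearIndependent K fun y : Σ x, Fin (len x) => (d ^ (y.2 : ℕ)) (e y.1) := by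
  classical
  rw [linearIndependent_iff']
  intro s g hg
  by_contra! hne
  obtain ⟨i, his, hi⟩ := hne
  -- The number of steps to the last element of the string. In a nontrivial relation, take a term of
  -- maximal height and apply that power of `d`: lower terms die, and the terms of maximal height
  -- become last elements.
  let ht : (Σ x, Fin (len x)) → ℕ := fun y => len y.1 - 1 - y.2
  obtain ⟨i₀, hi₀, hmax⟩ := (s.filter fun y => g y ≠ 0).exists_max_image ht
    ⟨i, Finset.mem_filter.2 ⟨his, hi⟩⟩
  rw [Finset.mem_filter] at hi₀
  have hli' := hli.comp (fun y : {y // ht y = ht i₀} => y.1.1) (by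
    rintro ⟨⟨x, j⟩, hx⟩ ⟨⟨x', j'⟩, hx'⟩ (h : x = x')
    subst h
    have h1 := j.2
    have h2 := j'.2
    have : j = j' := Fin.ext (by simp only [ht] at hx hx'; omega)
    subst this
    rfl)
  refine hi₀.2 (linearIndependent_iff'.1 hli' (s.subtype _) (fun y => g y) ?_ ⟨i₀, rfl⟩
    (Finset.mem_subtype.2 hi₀.1))
  have h0 := congrArg (d ^ ht i₀) hg
  rw [map_sum, map_zero] at h0
  refine (Finset.sum_subtype_eq_sum_filter (s := s) (p := fun y => ht y = ht i₀)
    (fun y => g y • (d ^ (len y.1 - 1)) (e y.1))).trans ?_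
  rw [← h0, Finset.sum_filter]
  refine Finset.sum_congr rfl fun y hy => ?_
  have hy2 := y.2.2
  rw [map_smul, ← Module.End.mul_apply, ← pow_add]
  split_ifs with h
  · have : ht i₀ + y.2 = len y.1 - 1 := by simp only [← h, ht]; omega
    rw [this]
  · by_cases hgy : g y = 0
    · rw [hgy, zero_smul]
    · have hlt : ht y < ht i₀ :=
        lt_of_le_of_ne (hmax y (Finset.mem_filter.2 ⟨hy, hgy⟩)) h
      obtain ⟨r, hr⟩ : ∃ r, ht i₀ + y.2 = r + len y.1 :=
        ⟨ht i₀ + y.2 - len y.1, by simp only [ht] at hlt ⊢; omega⟩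
      rw [hr, pow_add, Module.End.mul_apply, he, map_zero, smul_zero]

namespace PDGModule

section

variable {p n : ℕ} {k : Type u} [Field k]

/-! ### Homogeneous bases from the fiber -/

/-- The projection `M → M/IM`. -/
noncomputable def fiberProj (M : PDGModule.{u, v} p n k) :
    M.carrier →ₗ[MvPolynomial (Fin n) k] M.fiber.carrier := M.augSub.proj

theorem fiberProj_eq_zero (M : PDGModule.{u, v} p n k) {m : M.carrier} :
    M.fiberProj m = 0 ↔ m ∈ M.augSubmodule := M.augSub.proj_eq_zero

theorem fiberProj_surjective (M : PDGModule.{u, v} p n k) : Function.Surjective M.fiberProj :=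
  Submodule.mkQ_surjective _

theorem fiberProj_d_pow (M : PDGModule.{u, v} p n k) (s : ℕ) (m : M.carrier) :
    M.fiberProj ((M.d ^ s) m) = (M.fiber.d ^ s) (M.fiberProj m) := M.augSub.proj_d_pow s m

theorem fiberProj_mem_gr (M : PDGModule.{u, v} p n k) {l : ℤ} {m : M.carrier} (hm : m ∈ M.gr l) :
    M.fiberProj m ∈ M.fiber.gr l := M.augSub.proj_mem_gr hm

theorem exists_fiberProj_eq (M : PDGModule.{u, v} p n k) {l : ℤ} {x : M.fiber.carrier}
    (hx : x ∈ M.fiber.gr l) : ∃ m ∈ M.gr l, M.fiberProj m = x :=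
  M.augSub.exists_of_mem_gr_quot hx

theorem X_smul_fiber (M : PDGModule.{u, v} p n k) (i : Fin n) (x : M.fiber.carrier) :
    (MvPolynomial.X i : MvPolynomial (Fin n) k) • x = 0 := by
  obtain ⟨m, rfl⟩ := M.fiberProj_surjective x
  rw [← map_smul, fiberProj_eq_zero]
  exact M.smul_mem_augSubmodule (X_mem_augIdeal i) m

theorem smul_fiber (M : PDGModule.{u, v} p n k) (f : MvPolynomial (Fin n) k)
    (x : M.fiber.carrier) : f • x = MvPolynomial.constantCoeff f • x := by
  induction f using MvPolynomial.induction_on generalizing x with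
  | C a => rw [C_smul, MvPolynomial.constantCoeff_C]
  | add f g hf hg => rw [add_smul, hf, hg, map_add, add_smul]
  | mul_X f i hf =>
    rw [mul_smul, X_smul_fiber, smul_zero, map_mul, MvPolynomial.constantCoeff_X, mul_zero,
      zero_smul]

theorem span_fiberProj_eq_top (M : PDGModule.{u, v} p n k) {ι : Type w} {e : ι → M.carrier}
    (he : Submodule.span (MvPolynomial (Fin n) k) (Set.range e) = ⊤) :
    Submodule.span k (Set.range fun i => M.fiberProj (e i)) = ⊤ := by
  rw [eq_top_iff]
  rintro x -
  obtain ⟨m, rfl⟩ := M.fiberProj_surjective x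
  have hm : m ∈ Submodule.span (MvPolynomial (Fin n) k) (Set.range e) := he ▸ trivial
  induction hm using Submodule.closure_induction with
  | zero => rw [map_zero]; exact Submodule.zero_mem _
  | add x y _ _ hx hy => rw [map_add]; exact Submodule.add_mem _ hx hy
  | smul_mem a x hx =>
    obtain ⟨i, rfl⟩ := hx
    rw [map_smul, smul_fiber]
    exact Submodule.smul_mem _ _ (Submodule.subset_span ⟨i, rfl⟩)

theorem finite_fiber (M : PDGModule.{u, v} p n k) (hfg : M.IsFG) :
    Module.Finite k M.fiber.carrier := by
  have : Module.Finite (MvPolynomial (Fin n) k) M.carrier := hfg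
  obtain ⟨r, e, he⟩ := Module.Finite.exists_fin (R := MvPolynomial (Fin n) k) (M := M.carrier)
  classical
  exact ⟨⟨Finset.univ.image fun i => M.fiberProj (e i), by
    rw [Finset.coe_image, Finset.coe_univ, Set.image_univ, M.span_fiberProj_eq_top he]⟩⟩

/-- Nakayama gives generation. Independence over `A` comes from counting: `κ` has at most as many
elements as the dimension of the fiber, which is at most the rank of `M`, and a generating family of
at most that size is a basis. -/
theorem exists_basis_of_fiber (M : PDGModule.{u, v} p n k) (hfree : M.IsFree) (hfg : M.IsFG)
    {κ : Type w} {e : κ → M.carrier} {c : κ → ℤ} (he : ∀ i, e i ∈ M.gr (c i))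
    (hli : LinearIndependent k fun i => M.fiberProj (e i))
    (hspan : Submodule.span k (Set.range fun i => M.fiberProj (e i)) = ⊤) :
    ∃ b : Module.Basis κ (MvPolynomial (Fin n) k) M.carrier, ∀ i, b i = e i := by
  classical
  have hfin : Module.Finite (MvPolynomial (Fin n) k) M.carrier := hfg
  have hfinW := M.finite_fiber hfg
  obtain ⟨ι, b, c', hb⟩ := hfree
  have : Finite ι := Module.Finite.finite_basis b
  have := Fintype.ofFinite ι
  have : Finite κ := hli.finite
  have := Fintype.ofFinite κ
  -- Above the largest degree of a basis element, `M` vanishes.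
  have hbdd : ∃ L : ℤ, ∀ l, L < l → M.gr l = ⊥ := by
    obtain ⟨L, hL⟩ := (Set.finite_range c').bddAbove
    refine ⟨L, fun l hl => (Submodule.eq_bot_iff _).2 fun m hm => ?_⟩
    have h := mem_span_of_mem_gr hb b.span_eq hm
    have he : {i | l ≤ c' i} = ∅ := by
      ext i
      simpa using lt_of_le_of_lt (hL ⟨i, rfl⟩) hl
    rw [he, Set.image_empty, Submodule.span_empty] at h
    exact (Submodule.mem_bot _).1 h
  have hspanA : Submodule.span (MvPolynomial (Fin n) k) (Set.range e) = ⊤ := by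
    refine span_eq_top_of_sup_augSubmodule hbdd ?_ ?_
    · rw [← Set.image_univ]
      exact M.isHomog_span he Set.univ
    · rw [eq_top_iff]
      rintro m -
      have hle : Submodule.span k (Set.range fun i => M.fiberProj (e i)) ≤
          ((Submodule.span (MvPolynomial (Fin n) k) (Set.range e)).restrictScalars k).map
            (M.fiberProj.restrictScalars k) := by
        rw [Submodule.span_le]
        rintro _ ⟨i, rfl⟩
        exact ⟨e i, Submodule.subset_span ⟨i, rfl⟩, rfl⟩
      obtain ⟨s, hs, hsm⟩ := hle (hspan ▸ Submodule.mem_top : M.fiberProj m ∈ _)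
      refine Submodule.mem_sup.2 ⟨s, hs, m - s, ?_, by abel⟩
      rw [← fiberProj_eq_zero, map_sub, sub_eq_zero]
      exact hsm.symm
  have hcard : Fintype.card κ ≤ Module.finrank (MvPolynomial (Fin n) k) M.carrier := by
    rw [Module.finrank_eq_card_basis b]
    refine hli.fintype_card_le_finrank.trans ?_
    have := finrank_range_le_card (R := k) (fun i => M.fiberProj (b i))
    rwa [Set.finrank, M.span_fiberProj_eq_top b.span_eq, finrank_top] at this
  exact ⟨Module.Basis.mk (linearIndependent_of_top_le_span_of_card_le_finrank hspanA.ge hcard)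
    hspanA.ge, fun i => by rw [Module.Basis.mk_apply]⟩

/-! ### Splitting off strings of length `p` -/

theorem component_map_smul {M N : PDGModule.{u, v} p n k}
    (φ : M.carrier →ₗ[MvPolynomial (Fin n) k] N.carrier) (q : ℤ) (f : MvPolynomial (Fin n) k) :
    ∀ (c l : ℤ) (m : M.carrier), m ∈ M.gr c → φ m ∈ N.gr (c + q) →
      φ (M.component l (f • m)) = N.component (l + q) (φ (f • m)) := by
  induction f using MvPolynomial.induction_on with
  | C a =>
    intro c l m hm hφ
    have h1 : (MvPolynomial.C a : MvPolynomial (Fin n) k) • m ∈ M.gr c := by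
      rw [C_smul]; exact Submodule.smul_mem _ _ hm
    have h2 : φ ((MvPolynomial.C a : MvPolynomial (Fin n) k) • m) ∈ N.gr (c + q) := by
      rw [map_smul, C_smul]; exact Submodule.smul_mem _ _ hφ
    by_cases hc : c = l
    · subst hc
      rw [M.component_of_mem h1, N.component_of_mem h2]
    · rw [M.component_of_mem_ne h1 hc, N.component_of_mem_ne h2 (by omega), map_zero]
  | add f g hf hg =>
    intro c l m hm hφ
    rw [add_smul, map_add, map_add, map_add, map_add, hf c l m hm hφ, hg c l m hm hφ]
  | mul_X f i hf =>
    intro c l m hm hφ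
    rw [mul_smul]
    refine hf (c - 1) l _ (M.X_smul_mem i c m hm) ?_
    rw [map_smul]
    have := N.X_smul_mem i _ _ hφ
    rwa [show c - 1 + q = c + q - 1 by ring]

/-- A linear map is homogeneous of degree `q` if it is so on a homogeneous generating set. -/
theorem map_mem_gr_of_generators {M N : PDGModule.{u, v} p n k}
    (φ : M.carrier →ₗ[MvPolynomial (Fin n) k] N.carrier) (q : ℤ) {ι : Type w} {e : ι → M.carrier}
    {c : ι → ℤ} (he : ∀ i, e i ∈ M.gr (c i))
    (hspan : Submodule.span (MvPolynomial (Fin n) k) (Set.range e) = ⊤)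
    (h : ∀ i, φ (e i) ∈ N.gr (c i + q)) (l : ℤ) (m : M.carrier) (hm : m ∈ M.gr l) :
    φ m ∈ N.gr (l + q) := by
  rw [← M.component_of_mem hm]
  have key : φ (M.component l m) = N.component (l + q) (φ m) := by
    clear hm
    have hm : m ∈ Submodule.span (MvPolynomial (Fin n) k) (Set.range e) := hspan ▸ trivial
    induction hm using Submodule.closure_induction with
    | zero => simp only [map_zero]
    | add x y _ _ hx hy => simp only [map_add, hx, hy]
    | smul_mem a x hx =>
      obtain ⟨i, rfl⟩ := hx
      exact component_map_smul φ q a _ l _ (he i) (h i)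
  rw [key]
  exact N.component_mem _ _

end

end PDGModule

/-! ### Contractible direct summands -/

namespace PDGModule

section

variable {p n : ℕ} {k : Type u} [Field k]

/-- The endomorphism `∑ d^{p-1-i} h d^i`. -/
noncomputable def homotopyMap (M : PDGModule.{u, v} p n k) (h : Module.End (MvPolynomial (Fin n) k) M.carrier) :
    Module.End (MvPolynomial (Fin n) k) M.carrier :=
  ∑ i ∈ Finset.range p, M.d ^ (p - 1 - i) * (h * M.d ^ i)

/-- Both products are the sum of `d^{p-i} h d^i` over `0 ≤ i ≤ p` with one end term missing, and the
end terms vanish because `d^p = 0`. -/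
theorem homotopyMap_comm (M : PDGModule.{u, v} p n k)
    (h : Module.End (MvPolynomial (Fin n) k) M.carrier) :
    M.homotopyMap h * M.d = M.d * M.homotopyMap h := by
  have hsum : ∀ T : ℕ → Module.End (MvPolynomial (Fin n) k) M.carrier, T 0 = 0 → T p = 0 →
      ∑ i ∈ Finset.range p, T (i + 1) = ∑ i ∈ Finset.range p, T i := by
    intro T h0 hp
    have := (Finset.sum_range_succ' T p).symm.trans (Finset.sum_range_succ T p)
    rwa [h0, hp, add_zero, add_zero] at this
  have := hsum (fun i => M.d ^ (p - i) * (h * M.d ^ i)) (by simp [M.d_pow]) (by simp [M.d_pow])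
  rw [homotopyMap, Finset.sum_mul, Finset.mul_sum]
  refine (Finset.sum_congr rfl fun i hi => ?_).trans (this.trans (Finset.sum_congr rfl fun i hi => ?_))
  · rw [mul_assoc, mul_assoc, ← pow_succ, Nat.sub_sub, add_comm 1 i]
  · rw [← mul_assoc M.d, ← pow_succ', show p - 1 - i + 1 = p - i by
      have := Finset.mem_range.1 hi; omega]

theorem homotopyMap_mem_gr (M : PDGModule.{u, v} p n k)
    {h : Module.End (MvPolynomial (Fin n) k) M.carrier}
    (hh : ∀ l, ∀ m ∈ M.gr l, h m ∈ M.gr (l + ((p : ℤ) - 1))) {l : ℤ} {m : M.carrier}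
    (hm : m ∈ M.gr l) : M.homotopyMap h m ∈ M.gr l := by
  rw [homotopyMap, LinearMap.sum_apply]
  refine Submodule.sum_mem _ fun i hi => ?_
  have hi := Finset.mem_range.1 hi
  refine M.d_pow_mem (l := l - i + ((p : ℤ) - 1)) _ (by omega) ?_
  exact hh _ _ (M.d_pow_mem i rfl hm)

/-- An idempotent `π = ∑ d^{p-1-i} h d^i` splits off a contractible direct summand. -/
theorem exists_complement_of_isIdempotentElem (M : PDGModule.{u, v} p n k)
    {h : Module.End (MvPolynomial (Fin n) k) M.carrier}
    (hh : ∀ l, ∀ m ∈ M.gr l, h m ∈ M.gr (l + ((p : ℤ) - 1)))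
    (hid : IsIdempotentElem (M.homotopyMap h)) :
    ∃ (N : PDGModule.{u, v} p n k) (f : Hom M N), M.HomotopyEquivalent N ∧
      Function.Surjective f.toLin ∧ ∀ m, f.toLin m = 0 ↔ M.homotopyMap h m = m := by
  set π := M.homotopyMap h with hπ
  have hcomm : ∀ m, (1 - π) (M.d m) = M.d ((1 - π) m) := fun m => by
    have := congrArg (fun φ => φ m) (M.homotopyMap_comm h)
    simp only [Module.End.mul_apply, ← hπ] at this
    simp only [LinearMap.sub_apply, Module.End.one_apply, map_sub, this]
  have hgr : ∀ l, ∀ m ∈ M.gr l, (1 - π) m ∈ M.gr l := fun l m hm =>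
    Submodule.sub_mem _ hm (M.homotopyMap_mem_gr hh hm)
  have hfix : ∀ m, (1 - π) ((1 - π) m) = (1 - π) m := fun m =>
    congrArg (fun φ => φ m) hid.one_sub.eq
  let P : Sub M :=
    { toSubmodule := LinearMap.range (1 - π)
      homogeneous := by
        rintro _ ⟨m, rfl⟩
        induction m using M.homogeneous_induction with
        | h l m hm =>
          exact Submodule.mem_iSup_of_mem l (Submodule.mem_inf.2 ⟨⟨m, rfl⟩, hgr l m hm⟩)
        | hadd x y hx hy => rw [map_add]; exact Submodule.add_mem _ hx hy
      d_mem := by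
        rintro _ ⟨m, rfl⟩
        exact ⟨M.d m, hcomm m⟩ }
  let f : Hom M P.toPDG :=
    { toLin := (1 - π).rangeRestrict
      map_gr := hgr
      comm := LinearMap.ext fun m => Subtype.ext (hcomm m) }
  let g : Hom P.toPDG M :=
    { toLin := P.incl
      map_gr := fun l m hm => hm
      comm := rfl }
  -- The complement is the image of `1 - π`. On `M` the composite is `1 - π`, homotopic to the
  -- identity through `-h`; on the complement it is the identity.
  refine ⟨P.toPDG, f, ⟨f, g, ⟨-h, ?_, ?_⟩, ⟨0, ?_, ?_⟩⟩, LinearMap.surjective_rangeRestrict _,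
    fun m => ?_⟩
  · intro l m hm
    exact Submodule.neg_mem _ (hh l m hm)
  · have h1 : g.toLin ∘ₗ f.toLin = 1 - π := rfl
    rw [h1, hπ, homotopyMap]
    change 1 - _ - 1 = _
    rw [sub_sub_cancel_left, ← Finset.sum_neg_distrib]
    refine Finset.sum_congr rfl fun i _ => ?_
    change _ = M.d ^ (p - 1 - i) * (-h * M.d ^ i)
    rw [neg_mul, mul_neg]
  · intro l m _
    exact Submodule.zero_mem _
  · have h2 : f.toLin ∘ₗ g.toLin = LinearMap.id := by
      refine LinearMap.ext fun m => Subtype.ext ?_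
      obtain ⟨_, m, rfl⟩ := m
      exact hfix m
    rw [h2, sub_self]
    exact (Finset.sum_eq_zero fun i _ => by rw [LinearMap.zero_comp, LinearMap.comp_zero]).symm
  · refine Subtype.ext_iff.trans ?_
    change (1 - π) m = 0 ↔ _
    rw [LinearMap.sub_apply, sub_eq_zero, Module.End.one_apply, eq_comm]

theorem hom_d_pow {M : PDGModule.{u, v} p n k} {N : PDGModule.{u, w} p n k} (f : Hom M N) (r : ℕ)
    (m : M.carrier) : f.toLin ((M.d ^ r) m) = (N.d ^ r) (f.toLin m) := by
  induction r generalizing m with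
  | zero => rfl
  | succ r ih =>
    rw [pow_succ, pow_succ, Module.End.mul_apply, Module.End.mul_apply, ih]
    exact congrArg _ (congrArg (fun φ => φ m) f.comm)

theorem d_pow_eq_zero (M : PDGModule.{u, v} p n k) {r : ℕ} (hr : p ≤ r) (m : M.carrier) :
    (M.d ^ r) m = 0 := by
  rw [← Nat.sub_add_cancel hr, pow_add, M.d_pow, mul_zero]
  rfl

/-- Strings of length `p` can be split off up to homotopy equivalence. -/
theorem exists_splitting (hp : 0 < p) (M : PDGModule.{u, v} p n k) {α β : Type v}
    {len : α ⊕ β → ℕ} (hlen : ∀ a, len (Sum.inl a) = p) {top : α ⊕ β → M.carrier} {c : α ⊕ β → ℤ}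
    (htop : ∀ x, top x ∈ M.gr (c x))
    (b : Module.Basis (Σ x, Fin (len x)) (MvPolynomial (Fin n) k) M.carrier)
    (hb : ∀ y, b y = (M.d ^ (y.2 : ℕ)) (top y.1)) :
    ∃ (N : PDGModule.{u, v} p n k) (f : Hom M N), M.HomotopyEquivalent N ∧
      ∃ b' : Module.Basis (Σ x, Fin (len (Sum.inr x))) (MvPolynomial (Fin n) k) N.carrier,
        ∀ y, b' y = (N.d ^ (y.2 : ℕ)) (f.toLin (top (Sum.inr y.1))) := by
  classical
  -- `h` undoes `d^{p-1}` on the strings of length `p`: it sends the last element to the first and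
  -- kills all other basis elements.
  let h : Module.End (MvPolynomial (Fin n) k) M.carrier :=
    b.constr (MvPolynomial (Fin n) k) fun y =>
      if y.1.isLeft ∧ (y.2 : ℕ) = p - 1 then top y.1 else 0
  have hh0 : ∀ y, h (b y) = if y.1.isLeft ∧ (y.2 : ℕ) = p - 1 then top y.1 else 0 := fun y =>
    b.constr_basis _ _ _
  have hbgr : ∀ y, b y ∈ M.gr (c y.1 - (y.2 : ℕ)) := fun y => by
    rw [hb]; exact M.d_pow_mem _ rfl (htop _)
  have hh : ∀ l, ∀ m ∈ M.gr l, h m ∈ M.gr (l + ((p : ℤ) - 1)) := by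
    refine map_mem_gr_of_generators h _ hbgr b.span_eq fun y => ?_
    rw [hh0]
    split_ifs with hy
    · have : c y.1 - (y.2 : ℕ) + ((p : ℤ) - 1) = c y.1 := by omega
      rw [this]
      exact htop _
    · exact Submodule.zero_mem _
  have hbd : ∀ a (j : ℕ) (hj : j < p),
      (M.d ^ j) (top (Sum.inl a)) = b ⟨Sum.inl a, ⟨j, (hlen a).symm ▸ hj⟩⟩ := fun a j hj => by
    rw [hb]
  let s : Set (Σ x, Fin (len x)) := {y | y.1.isLeft}
  have hC : ∀ a (j : ℕ), (M.d ^ j) (top (Sum.inl a)) ∈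
      Submodule.span (MvPolynomial (Fin n) k) (b '' s) := by
    intro a j
    by_cases hj : j < p
    · rw [hbd a j hj]
      exact Submodule.subset_span (Set.mem_image_of_mem b rfl)
    · rw [M.d_pow_eq_zero (not_lt.1 hj)]
      exact Submodule.zero_mem _
  -- On the remaining strings `π` need not vanish, since powers of `d` may lead from them into
  -- strings of length `p`. Idempotence only needs that `π` has its image in the span of the latter
  -- and fixes that span.
  have hrange : ∀ m, M.homotopyMap h m ∈ Submodule.span (MvPolynomial (Fin n) k) (b '' s) := by
    intro m
    rw [homotopyMap, LinearMap.sum_apply]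
    refine Submodule.sum_mem _ fun i _ => ?_
    rw [Module.End.mul_apply, Module.End.mul_apply]
    generalize (M.d ^ i) m = m
    have : (⊤ : Submodule (MvPolynomial (Fin n) k) M.carrier) ≤
        (Submodule.span (MvPolynomial (Fin n) k) (b '' s)).comap (M.d ^ (p - 1 - i) * h) := by
      rw [← b.span_eq, Submodule.span_le]
      rintro _ ⟨⟨x, j⟩, rfl⟩
      change (M.d ^ (p - 1 - i)) (h (b _)) ∈
        Submodule.span (MvPolynomial (Fin n) k) (b '' s)
      rw [hh0]
      split_ifs with hy
      · obtain ⟨a, rfl⟩ := Sum.isLeft_iff.1 hy.1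
        exact hC a _
      · rw [map_zero]; exact Submodule.zero_mem _
    exact this trivial
  have hfix : ∀ m ∈ Submodule.span (MvPolynomial (Fin n) k) (b '' s), M.homotopyMap h m = m := by
    have : Submodule.span (MvPolynomial (Fin n) k) (b '' s) ≤
        LinearMap.eqLocus (M.homotopyMap h) LinearMap.id := by
      rw [Submodule.span_le]
      rintro _ ⟨⟨x, j⟩, hx, rfl⟩
      obtain ⟨a, rfl⟩ := Sum.isLeft_iff.1 hx
      have hj : (j : ℕ) < p := j.2.trans_eq (hlen a)
      change M.homotopyMap h (b _) = b _
      -- `h d^i` is nonzero on `d^j v` only for `i + j = p - 1`; then it gives `v`, and `d^{p-1-i} =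
      -- d^j` restores `d^j v`.
      rw [homotopyMap, LinearMap.sum_apply, hb,
        Finset.sum_eq_single_of_mem (p - 1 - (j : ℕ)) (Finset.mem_range.2 (by omega))]
      · simp only [Module.End.mul_apply]
        rw [← Module.End.mul_apply (M.d ^ (p - 1 - (j : ℕ))), ← pow_add,
          hbd a _ (by omega : p - 1 - (j : ℕ) + j < p), hh0, if_pos ⟨rfl, by simp; omega⟩]
        congr 2
        omega
      · intro i hi hij
        have hi := Finset.mem_range.1 hi
        simp only [Module.End.mul_apply]
        rw [← Module.End.mul_apply (M.d ^ i), ← pow_add]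
        by_cases hij' : i + (j : ℕ) < p
        · rw [hbd a _ hij', hh0, if_neg (by simp; omega), map_zero]
        · rw [M.d_pow_eq_zero (not_lt.1 hij'), map_zero, map_zero]
    exact fun m hm => this hm
  obtain ⟨N, f, hMN, hsurj, hker⟩ := M.exists_complement_of_isIdempotentElem hh
    (LinearMap.ext fun m => hfix _ (hrange m))
  have hker' : LinearMap.ker f.toLin = Submodule.span (MvPolynomial (Fin n) k) (b '' s) := by
    ext m
    rw [LinearMap.mem_ker, hker]
    exact ⟨fun hm => hm ▸ hrange m, hfix m⟩
  let ir : (Σ x, Fin (len (Sum.inr x))) → Σ x, Fin (len x) := fun y => ⟨Sum.inr y.1, y.2⟩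
  have hir : Function.Injective ir := by
    rintro ⟨x, j⟩ ⟨x', j'⟩ hxx
    simp only [ir, Sigma.mk.injEq, Sum.inr.injEq] at hxx
    obtain ⟨rfl, hj⟩ := hxx
    simpa using hj
  have hrs : Set.range ir = sᶜ := by
    ext ⟨x | x, j⟩
    · simp [ir, s]
    · simp [ir, s]
  have hli : LinearIndependent (MvPolynomial (Fin n) k) fun y => f.toLin (b (ir y)) := by
    refine (b.linearIndependent.comp ir hir).map ?_
    rw [hker', Set.range_comp, hrs]
    exact b.linearIndependent.disjoint_span_image disjoint_compl_left
  have hspan : ⊤ ≤ Submodule.span (MvPolynomial (Fin n) k)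
      (Set.range fun y => f.toLin (b (ir y))) := by
    rw [← LinearMap.range_eq_top.2 hsurj, LinearMap.range_eq_map, ← b.span_eq, Submodule.map_span,
      Submodule.span_le]
    rintro _ ⟨_, ⟨y, rfl⟩, rfl⟩
    by_cases hy : y ∈ s
    · have : f.toLin (b y) = 0 := by
        rw [← LinearMap.mem_ker, hker']
        exact Submodule.subset_span (Set.mem_image_of_mem b hy)
      rw [this]
      exact Submodule.zero_mem _
    · obtain ⟨z, rfl⟩ : y ∈ Set.range ir := hrs ▸ hy
      exact Submodule.subset_span ⟨z, rfl⟩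
  refine ⟨N, f, hMN, Module.Basis.mk hli hspan, fun y => ?_⟩
  rw [Module.Basis.mk_apply, hb, hom_d_pow]

end

end PDGModule

namespace PDGModule

section

variable {p n : ℕ} {k : Type u} [Field k]

/-! ### Composition series from filtered strings -/

/-- Inside a string `d` shifts basis elements, so a span of whole strings is stable as soon as `d`
maps the last elements back into it. -/
theorem exists_sub_span {N : PDGModule.{u, v} p n k} {β : Type w} {len : β → ℕ}
    {top : β → N.carrier} {c : β → ℤ} (htop : ∀ x, top x ∈ N.gr (c x))
    (b : Module.Basis (Σ x, Fin (len x)) (MvPolynomial (Fin n) k) N.carrier)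
    (hb : ∀ y, b y = (N.d ^ (y.2 : ℕ)) (top y.1)) (s : Set β)
    (hd : ∀ x ∈ s, (N.d ^ len x) (top x) ∈
      Submodule.span (MvPolynomial (Fin n) k) (b '' {y | y.1 ∈ s})) :
    ∃ F : Sub N, F.toSubmodule = Submodule.span (MvPolynomial (Fin n) k) (b '' {y | y.1 ∈ s}) := by
  have hbgr : ∀ y, b y ∈ N.gr (c y.1 - (y.2 : ℕ)) := fun y => by
    rw [hb]; exact N.d_pow_mem _ rfl (htop _)
  refine ⟨⟨_, fun m hm => (N.isHomog_span hbgr _).mem_iSup hm, fun m hm => ?_⟩, rfl⟩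
  revert m
  suffices Submodule.span (MvPolynomial (Fin n) k) (b '' {y | y.1 ∈ s}) ≤ Submodule.comap N.d
    (Submodule.span (MvPolynomial (Fin n) k) (b '' {y | y.1 ∈ s})) from this
  rw [Submodule.span_le]
  rintro _ ⟨⟨x, j⟩, hx, rfl⟩
  change N.d (b _) ∈ Submodule.span (MvPolynomial (Fin n) k) (b '' {y | y.1 ∈ s})
  rw [hb, ← Module.End.mul_apply, ← pow_succ']
  by_cases hj : (j : ℕ) + 1 < len x
  · exact Submodule.subset_span ⟨⟨x, ⟨j + 1, hj⟩⟩, hx, hb _⟩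
  · have : (j : ℕ) + 1 = len x := by have := j.2; omega
    rw [this]
    exact hd x hx

/-- The strings indexed by `t \ s` survive as a basis of the quotient, and `hd` makes them end
there: `d^q` of a first element becomes zero. -/
theorem isSumOfStrings_quot {N : PDGModule.{u, v} p n k} {β : Type v} {len : β → ℕ}
    {top : β → N.carrier} {c : β → ℤ} (htop : ∀ x, top x ∈ N.gr (c x))
    (b : Module.Basis (Σ x, Fin (len x)) (MvPolynomial (Fin n) k) N.carrier)
    (hb : ∀ y, b y = (N.d ^ (y.2 : ℕ)) (top y.1)) {s t : Set β} {q : ℕ} (hq : 0 < q)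
    (hlen : ∀ x ∈ t, x ∉ s → len x = q) {P Q : Sub N}
    (hP : P.toSubmodule = Submodule.span (MvPolynomial (Fin n) k) (b '' {y | y.1 ∈ t}))
    (hQ : Q.toSubmodule = Submodule.span (MvPolynomial (Fin n) k) (b '' {y | y.1 ∈ s}))
    (hPQ : Q.toSubmodule ≤ P.toSubmodule)
    (hd : ∀ x ∈ t, x ∉ s → (N.d ^ len x) (top x) ∈ Q.toSubmodule) :
    (P.restrict Q hPQ).quot.IsSumOfStrings q := by
  have hmem : ∀ y : Σ x, Fin (len x), y.1 ∈ t → b y ∈ P.toSubmodule := fun y hy =>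
    hP ▸ Submodule.subset_span ⟨y, hy, rfl⟩
  let ι := {x : β // x ∈ t ∧ x ∉ s}
  have hlenι : ∀ x : ι, len x.1 = q := fun x => hlen x.1 x.2.1 x.2.2
  let i : ι × Fin q → Σ x, Fin (len x) := fun y => ⟨y.1.1, y.2.cast (hlenι y.1).symm⟩
  have hi : Function.Injective i := by
    rintro ⟨⟨x, hx⟩, j⟩ ⟨⟨x', hx'⟩, j'⟩ h
    simp only [i, Sigma.mk.injEq] at h
    obtain ⟨rfl, h⟩ := h
    simpa using h
  let ψ := (P.restrict Q hPQ).proj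
  have hψ : ∀ (a : ℕ) (m : P.toPDG.carrier), ((P.restrict Q hPQ).quot.d ^ a) (ψ m) =
      ψ ((P.toPDG.d ^ a) m) := fun a m => ((P.restrict Q hPQ).proj_d_pow a m).symm
  let e : ι × Fin q → P.toPDG.carrier := fun y => ⟨b (i y), hmem _ y.1.2.1⟩
  have htopP : ∀ x : ι, top x.1 ∈ P.toSubmodule := fun x => by
    have := hmem (i (x, ⟨0, hq⟩)) x.2.1
    rw [hb] at this
    exact this
  have hinj : Function.Injective P.incl := Subtype.val_injective
  let topP : ι → P.toPDG.carrier := fun x => ⟨top x.1, htopP x⟩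
  have heq : ∀ y : ι × Fin q, e y = (P.toPDG.d ^ (y.2 : ℕ)) (topP y.1) := fun y =>
    hinj ((hb _).trans (P.incl_d_pow _ (topP y.1)).symm)
  have hincl : ∀ m : P.toPDG.carrier, ψ m = 0 ↔ P.incl m ∈ Q.toSubmodule := fun m =>
    (P.restrict Q hPQ).proj_eq_zero
  have hcomp : P.incl ∘ e = b ∘ i := rfl
  have hli : LinearIndependent (MvPolynomial (Fin n) k) (ψ ∘ e) := by
    have hli : LinearIndependent (MvPolynomial (Fin n) k) (P.incl ∘ e) :=
      hcomp ▸ b.linearIndependent.comp i hi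
    refine LinearIndependent.map hli.of_comp ?_
    rw [Submodule.disjoint_def]
    intro m hm1 hm2
    refine hinj (((Submodule.disjoint_def.1 (b.linearIndependent.disjoint_span_image
      (s := {y | y.1 ∈ s}) (t := Set.range i) ?_) (P.incl m) ?_ ?_)).trans (map_zero _).symm)
    · rw [Set.disjoint_right]
      rintro _ ⟨y, rfl⟩ hy
      exact y.1.2.2 hy
    · rw [← hQ]
      exact (hincl m).1 hm2
    · have := Submodule.mem_map_of_mem (f := P.incl) hm1
      rwa [Submodule.map_span, ← Set.range_comp, hcomp,
        Set.range_comp] at this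
  have hspan : ⊤ ≤ Submodule.span (MvPolynomial (Fin n) k) (Set.range (ψ ∘ e)) := by
    have hle : P.toSubmodule ≤ (Submodule.comap ψ (Submodule.span (MvPolynomial (Fin n) k)
        (Set.range (ψ ∘ e)))).map P.incl := by
      rw [hP, Submodule.span_le]
      rintro _ ⟨y, hy, rfl⟩
      refine ⟨⟨b y, hmem y hy⟩, ?_, rfl⟩
      by_cases hys : y.1 ∈ s
      · have : ψ ⟨b y, hmem y hy⟩ = 0 :=
          (hincl _).2 (hQ ▸ Submodule.subset_span ⟨y, hys, rfl⟩)
        change ψ ⟨b y, hmem y hy⟩ ∈ Submodule.span (MvPolynomial (Fin n) k) (Set.range (ψ ∘ e))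
        rw [this]
        exact Submodule.zero_mem _
      · obtain ⟨x, j⟩ := y
        exact Submodule.subset_span ⟨(⟨x, hy, hys⟩, j.cast (hlen x hy hys)), rfl⟩
    rintro m -
    obtain ⟨m, rfl⟩ : ∃ m', ψ m' = m := Submodule.mkQ_surjective _ m
    obtain ⟨m', hm', h⟩ := hle m.2
    rw [← hinj h]
    exact hm'
  refine ⟨ι, fun x => ψ (topP x), fun x => c x.1, fun x => ?_, fun x => ?_,
    Module.Basis.mk hli hspan, fun x a => ?_⟩
  · exact (P.restrict Q hPQ).proj_mem_gr (htop x.1)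
  · refine (hψ q _).trans ((hincl _).2 ?_)
    rw [P.incl_d_pow, ← hlenι x]
    exact hd x.1 x.2.1 x.2.2
  · rw [Module.Basis.mk_apply]
    exact (congrArg ψ (heq (x, a))).trans (hψ a _).symm

/-- Level `r` of the series is spanned by the strings of stage below `r`. That every stage is
occupied makes the inclusions strict; a common length per stage gives the quotients their shape. -/
theorem hasCompositionSeries_of_stages (hp : 2 ≤ p) {N : PDGModule.{u, v} p n k} {β : Type v}
    {len : β → ℕ} {top : β → N.carrier} {c : β → ℤ} (htop : ∀ x, top x ∈ N.gr (c x))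
    (b : Module.Basis (Σ x, Fin (len x)) (MvPolynomial (Fin n) k) N.carrier)
    (hb : ∀ y, b y = (N.d ^ (y.2 : ℕ)) (top y.1)) (stage : β → ℕ)
    (hd : ∀ x, (N.d ^ len x) (top x) ∈
      Submodule.span (MvPolynomial (Fin n) k) (b '' {y | stage y.1 < stage x}))
    (R : ℕ) (hR : ∀ x, stage x < R)
    (hstage : ∀ r < R, (∃ x, stage x = r) ∧
      ∃ q, (q = 1 ∨ q = p - 1) ∧ ∀ x, stage x = r → len x = q) :
    N.HasCompositionSeries R := by
  have hF : ∀ r, ∃ F : Sub N, F.toSubmodule =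
      Submodule.span (MvPolynomial (Fin n) k) (b '' {y | y.1 ∈ {x | stage x < r}}) := fun r =>
    exists_sub_span htop b hb _ fun x hx => by
      have hsub : {y : Σ x, Fin (len x) | stage y.1 < stage x} ⊆ {y | y.1 ∈ {x | stage x < r}} :=
        fun _ hy => lt_trans (Set.mem_ofPred.1 hy) hx
      exact Submodule.span_mono (Set.image_mono hsub) (hd x)
  choose F hF using hF
  refine ⟨F, ?_, ?_, fun r hr => ?_⟩
  · simp [hF]
  · simp [hF, hR, Set.image_univ, b.span_eq]
  · obtain ⟨⟨x, hx⟩, q, hq, hlen⟩ := hstage r hr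
    have hq0 : 0 < q := by omega
    have hle : (F r).toSubmodule ≤ (F (r + 1)).toSubmodule := by
      rw [hF, hF]
      have hsub : {y : Σ x, Fin (len x) | y.1 ∈ {x | stage x < r}} ⊆
        {y | y.1 ∈ {x | stage x < r + 1}} := fun _ hy =>
          lt_trans (Set.mem_ofPred.1 hy) (Nat.lt_succ_self r)
      exact Submodule.span_mono (Set.image_mono hsub)
    have hlt : (F r).toSubmodule < (F (r + 1)).toSubmodule := by
      refine lt_of_le_of_ne hle fun h => ?_
      let y : Σ x, Fin (len x) := ⟨x, ⟨0, (hlen x hx).symm ▸ hq0⟩⟩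
      have hy : b y ∈ (F (r + 1)).toSubmodule := by
        rw [hF]
        exact Submodule.subset_span ⟨y, hx.trans_lt (Nat.lt_succ_self r), rfl⟩
      rw [← h, hF] at hy
      exact b.linearIndependent.notMem_span_image (fun h : stage x < r => h.ne hx) hy
    have key : ((F (r + 1)).restrict (F r) hlt.le).quot.IsSumOfStrings q :=
      isSumOfStrings_quot htop b hb hq0 (s := {x | stage x < r}) (t := {x | stage x < r + 1})
        (fun x h1 h2 => hlen x (le_antisymm (Nat.lt_succ_iff.1 h1) (not_lt.1 h2))) (hF _) (hF _) _
        fun x h1 h2 => by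
          have hx : stage x = r := le_antisymm (Nat.lt_succ_iff.1 h1) (not_lt.1 h2)
          rw [hF, ← hx]
          exact hd x
    refine ⟨hlt, ?_⟩
    rcases hq with rfl | rfl
    · exact Or.inl key
    · exact Or.inr key

end

end PDGModule

namespace PDGModule

section

variable {p n : ℕ} {k : Type u} [Field k]

/-! ### Homology classes -/

theorem homClass_eq_iff (M : PDGModule.{u, v} p n k) {s : ℕ} {l : ℤ} {m m' : M.carrier}
    (hm : m ∈ M.cycles s l) (hm' : m' ∈ M.cycles s l) :
    M.homClass s l m hm = M.homClass s l m' hm' ↔ m - m' ∈ M.boundaries s l :=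
  Submodule.Quotient.eq _

theorem homClass_eq_zero (M : PDGModule.{u, v} p n k) {s : ℕ} {l : ℤ} {m : M.carrier}
    (hm : m ∈ M.cycles s l) : M.homClass s l m hm = 0 ↔ m ∈ M.boundaries s l :=
  Submodule.Quotient.mk_eq_zero _

theorem exists_homClass (M : PDGModule.{u, v} p n k) {s : ℕ} {l : ℤ} (ξ : M.H s l) :
    ∃ m hm, M.homClass s l m hm = ξ := by
  obtain ⟨⟨m, hm⟩, rfl⟩ := Submodule.Quotient.mk_surjective _ ξ
  exact ⟨m, hm, rfl⟩

theorem cycles_mono (M : PDGModule.{u, v} p n k) {s t : ℕ} (hst : s ≤ t) (l : ℤ) :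
    M.cycles s l ≤ M.cycles t l := fun m hm => by
  refine ⟨hm.1, ?_⟩
  change (M.d ^ t) m = 0
  rw [← Nat.sub_add_cancel hst, pow_add, Module.End.mul_apply, (mem_cycles.1 hm).2, map_zero]

theorem boundaries_mono (M : PDGModule.{u, v} p n k) {s t : ℕ} (hst : s ≤ t) (l : ℤ) :
    M.boundaries s l ≤ M.boundaries t l := fun m hm => by
  obtain ⟨x, hx, rfl⟩ := mem_boundaries.1 hm
  obtain ⟨e, he⟩ := Nat.exists_eq_add_of_le (Nat.sub_le_sub_left hst p)
  refine mem_boundaries.2 ⟨(M.d ^ e) x, M.d_pow_mem e (by rw [he]; push_cast; omega) hx, ?_⟩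
  rw [he, pow_add, Module.End.mul_apply]

theorem d_pow_mem_boundaries (M : PDGModule.{u, v} p n k) {r s : ℕ} (h : p - s = r) {l l' : ℤ}
    (hl : l = l' - r) {m : M.carrier} (hm : m ∈ M.gr l') : (M.d ^ r) m ∈ M.boundaries s l :=
  mem_boundaries.2 ⟨m, by rwa [show l + ((p - s : ℕ) : ℤ) = l' by omega], by rw [h]⟩

theorem linearIndependent_of_graded (W : PDGModule.{u, v} p n k) {κ : ℤ → Type w}
    {v : (Σ l, κ l) → W.carrier} (hv : ∀ y, v y ∈ W.gr y.1)
    (h : ∀ l, LinearIndependent k fun i : κ l => v ⟨l, i⟩) : LinearIndependent k v := by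
  classical
  rw [linearIndependent_iff']
  rintro s g hg ⟨l, i⟩ hi
  have hinj : Function.Injective (Sigma.mk l : κ l → Σ l, κ l) := sigma_mk_injective
  refine linearIndependent_iff'.1 (h l) (s.preimage (Sigma.mk l) hinj.injOn) (fun i => g ⟨l, i⟩)
    ?_ i (by simpa using hi)
  have h0 := congrArg (W.component l) hg
  rw [map_sum, map_zero] at h0
  rw [← h0]
  refine Eq.trans (Finset.sum_congr rfl fun i _ => ?_)
    (Finset.sum_preimage (Sigma.mk l) s hinj.injOn
    (fun y => W.component l (g y • v y)) fun y _ hy => ?_)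
  · exact (W.component_of_mem (Submodule.smul_mem _ _ (hv ⟨l, i⟩))).symm
  · refine W.component_of_mem_ne (Submodule.smul_mem _ _ (hv y)) fun hyl => hy ?_
    obtain ⟨l', i'⟩ := y
    obtain rfl : l' = l := hyl
    exact ⟨i', rfl⟩

/-! ### Consequences of the bijectivity of `i_*` and `d_*` -/

/-- The length of the strings whose last elements have degree `l`. -/
def stringLen (p : ℕ) (l : ℤ) : ℕ := if (p : ℤ) ∣ l then p - 1 else 1

/-- The bijectivity conditions on `i_*` and `d_*`. -/
structure HasBijectiveMaps (W : PDGModule.{u, v} p n k) : Prop where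
  i_bijective : ∀ l : ℤ, l ≡ p - 1 [ZMOD p] → ∀ s : ℕ, 1 ≤ s → s + 1 ≤ p - 1 →
    Function.Bijective (W.iMap s (s + 1) s.le_succ l)
  d_bijective : ∀ l : ℤ, l ≡ p - 2 [ZMOD p] → ∀ s : ℕ, 1 ≤ s → ∀ hs : s + 1 ≤ p - 1,
    Function.Bijective (W.dMap 1 (s + 1) s rfl (hs.trans (p.sub_le 1))
      (l - (p - 2 - s)) (l - (p - 2 - s) - (1 : ℕ)) rfl)

namespace HasBijectiveMaps

variable {W : PDGModule.{u, v} p n k} (hW : W.HasBijectiveMaps)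

include hW

/-- Injectivity of the iterated `i_*`, in terms of elements; `exists_cycle_one` is the surjectivity.
-/
theorem mem_boundaries_one {l : ℤ} (hl : l ≡ p - 1 [ZMOD p]) {m : W.carrier}
    (hm : m ∈ W.cycles 1 l) {s : ℕ} (hs : 1 ≤ s) (hsp : s ≤ p - 1) (hb : m ∈ W.boundaries s l) :
    m ∈ W.boundaries 1 l := by
  induction s, hs using Nat.le_induction with
  | base => exact hb
  | succ s hs ih =>
    refine ih (by omega) ?_
    have hm' := W.cycles_mono hs l hm
    rw [← homClass_eq_zero _ hm']
    refine (hW.i_bijective l hl s hs hsp).1 ?_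
    rw [map_zero, iMap, mapH_homClass, homClass_eq_zero]
    exact hb

theorem exists_cycle_one {l : ℤ} (hl : l ≡ p - 1 [ZMOD p]) {s : ℕ} (hs : 1 ≤ s)
    (hsp : s ≤ p - 1) {m : W.carrier} (hm : m ∈ W.cycles s l) :
    ∃ m' ∈ W.cycles 1 l, m - m' ∈ W.boundaries s l := by
  induction s, hs using Nat.le_induction generalizing m with
  | base => exact ⟨m, hm, by rw [sub_self]; exact Submodule.zero_mem _⟩
  | succ s hs ih =>
    obtain ⟨ξ, hξ⟩ := (hW.i_bijective l hl s hs hsp).2 (W.homClass _ _ m hm)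
    obtain ⟨m₁, hm₁, rfl⟩ := W.exists_homClass ξ
    rw [iMap, mapH_homClass, eq_comm, homClass_eq_iff] at hξ
    obtain ⟨m', hm', hb⟩ := ih (by omega) hm₁
    refine ⟨m', hm', ?_⟩
    have := Submodule.add_mem _ hξ (W.boundaries_mono s.le_succ l hb)
    simpa using this

theorem mem_boundaries_succ {l : ℤ} {s : ℕ} (hl : l ≡ s [ZMOD p]) (hs : 1 ≤ s)
    (hsp : s + 1 ≤ p - 1) {m : W.carrier} (hm : m ∈ W.cycles (s + 1) l)
    (hb : W.d m ∈ W.boundaries s (l - 1)) : m ∈ W.boundaries (s + 1) l := by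
  -- The maps `d_*` are indexed by the degree congruent to `p - 2` in which their chain starts,
  -- which lies `p - 2 - s` above.
  obtain ⟨l, rfl⟩ : ∃ l', l = l' - (p - 2 - s) := ⟨l + (p - 2 - s), by ring⟩
  have hl' : l ≡ p - 2 [ZMOD p] := by
    have := hl.add_right ((p : ℤ) - 2 - s)
    simpa using this
  rw [← homClass_eq_zero _ hm]
  refine (hW.d_bijective l hl' s hs hsp).1 ?_
  rw [map_zero, dMap, mapH_homClass, homClass_eq_zero]
  exact hb

theorem exists_sub_d_mem_boundaries {l : ℤ} {s : ℕ} (hl : l ≡ s [ZMOD p]) (hs : 1 ≤ s)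
    (hsp : s + 1 ≤ p - 1) {m : W.carrier} (hm : m ∈ W.cycles s (l - 1)) :
    ∃ m' ∈ W.cycles (s + 1) l, W.d m' - m ∈ W.boundaries s (l - 1) := by
  obtain ⟨l, rfl⟩ : ∃ l', l = l' - (p - 2 - s) := ⟨l + (p - 2 - s), by ring⟩
  have hl' : l ≡ p - 2 [ZMOD p] := by
    have := hl.add_right ((p : ℤ) - 2 - s)
    simpa using this
  obtain ⟨ξ, hξ⟩ := (hW.d_bijective l hl' s hs hsp).2 (W.homClass _ _ m hm)
  obtain ⟨m', hm', rfl⟩ := W.exists_homClass ξ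
  rw [dMap, mapH_homClass, homClass_eq_iff] at hξ
  exact ⟨m', hm', hξ⟩

/-- Injectivity of `d_*` makes a cycle `z` of degree `l` equal to `d^{p-s-1} y`, where `y` has
degree congruent to `-1` and `d^{p-s} y = 0`. Surjectivity of `i_*` writes `y` as a `1`-cycle plus
`d^s x`, and so `z = d^{p-1} x`. -/
theorem cycles_le_boundaries {l : ℤ} {s : ℕ} (hl : l ≡ s [ZMOD p]) (hs : 1 ≤ s)
    (hsp : s + 1 ≤ p - 1) : W.cycles 1 l ≤ W.boundaries 1 l := by
  intro z hz
  have h0 : W.d z = 0 := by simpa using (mem_cycles.1 hz).2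
  have hz' := hW.mem_boundaries_succ hl hs hsp (W.cycles_mono (by omega) l hz)
    (by rw [h0]; exact Submodule.zero_mem _)
  obtain ⟨y, hy, rfl⟩ := mem_boundaries.1 hz'
  have hyc : y ∈ W.cycles (p - s) (l + ((p - (s + 1) : ℕ) : ℤ)) := by
    refine mem_cycles.2 ⟨hy, ?_⟩
    rw [← h0, show p - s = (p - (s + 1)) + 1 by omega, pow_succ', Module.End.mul_apply]
  have hl' : l + ((p - (s + 1) : ℕ) : ℤ) ≡ p - 1 [ZMOD p] := by
    have := hl.add_right ((p - (s + 1) : ℕ) : ℤ)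
    rwa [show (s : ℤ) + ((p - (s + 1) : ℕ) : ℤ) = p - 1 by omega] at this
  obtain ⟨y', hy', hb⟩ := hW.exists_cycle_one hl' (by omega : 1 ≤ p - s) (by omega) hyc
  obtain ⟨x, hx, hxy⟩ := mem_boundaries.1 hb
  have hd : (W.d ^ (p - (s + 1))) y = (W.d ^ (p - 1)) x := by
    rw [← sub_eq_zero, show p - 1 = (p - (s + 1)) + (p - (p - s)) by omega, pow_add,
      Module.End.mul_apply, hxy, ← map_sub, sub_sub_cancel]
    exact (mem_cycles.1 (W.cycles_mono (by omega) _ hy')).2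
  rw [hd]
  exact W.d_pow_mem_boundaries rfl (by omega) hx

/-- Surjectivity of `d_*`, iterated `s - 1` times. The error at each step stays a boundary because
`d^{s-1} d^{p-s} = d^{p-1}`. -/
theorem exists_sub_d_pow_mem_boundaries {l : ℤ} (hl : (p : ℤ) ∣ l) {s : ℕ} (hs : 1 ≤ s)
    (hsp : s ≤ p - 1) {m : W.carrier} (hm : m ∈ W.cycles 1 l) :
    ∃ u ∈ W.cycles s (l + ((s - 1 : ℕ) : ℤ)), (W.d ^ (s - 1)) u - m ∈ W.boundaries 1 l := by
  induction s, hs using Nat.le_induction with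
  | base =>
    exact ⟨m, by simpa using hm, by simp⟩
  | succ s hs ih =>
    obtain ⟨u, hu, hb⟩ := ih (by omega)
    have hls : l + s ≡ s [ZMOD p] := by
      simpa using ((Int.modEq_zero_iff_dvd.2 hl).add_right (s : ℤ))
    rw [show l + ((s - 1 : ℕ) : ℤ) = l + s - 1 by omega] at hu
    obtain ⟨u', hu', hb'⟩ := hW.exists_sub_d_mem_boundaries hls hs hsp hu
    refine ⟨u', by simpa using hu', ?_⟩
    obtain ⟨x, hx, hxy⟩ := mem_boundaries.1 hb'
    have : (W.d ^ (s + 1 - 1)) u' - m = (W.d ^ (p - 1)) x + ((W.d ^ (s - 1)) u - m) := by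
      rw [show p - 1 = (s - 1) + (p - s) by omega, pow_add _ (s - 1), Module.End.mul_apply, hxy,
        map_sub, ← Module.End.mul_apply, ← pow_succ, show s + 1 - 1 = s - 1 + 1 by omega]
      abel
    rw [this]
    exact Submodule.add_mem _ (W.d_pow_mem_boundaries rfl (by omega) hx) hb

theorem exists_string_top (hp : 2 ≤ p) (l : ℤ) {m : W.carrier} (hm : m ∈ W.cycles 1 l) :
    ∃ u ∈ W.cycles (stringLen p l) (l + ((stringLen p l - 1 : ℕ) : ℤ)),
      (W.d ^ (stringLen p l - 1)) u - m ∈ W.boundaries 1 l := by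
  by_cases hl : (p : ℤ) ∣ l
  · rw [stringLen, if_pos hl]
    exact hW.exists_sub_d_pow_mem_boundaries hl (by omega) le_rfl hm
  · rw [stringLen, if_neg hl]
    exact ⟨m, by simpa using hm, by simp⟩

/-- `_1H_l = 0` unless `l` is congruent to `-1` or `0`. -/
theorem cycles_le_boundaries_of_not_dvd (hp : 2 ≤ p) {l : ℤ} (h1 : ¬ (p : ℤ) ∣ l)
    (h2 : ¬ (p : ℤ) ∣ l + 1) : W.cycles 1 l ≤ W.boundaries 1 l := by
  have hp0 : (0 : ℤ) < p := by omega
  have hr0 := Int.emod_nonneg l hp0.ne'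
  have hrp := Int.emod_lt_of_pos l hp0
  have hr1 : l % p ≠ 0 := fun h => h1 (Int.dvd_of_emod_eq_zero h)
  have hr2 : l % p ≠ p - 1 := fun h => h2 ⟨l / p + 1, by
    have := Int.emod_add_mul_ediv l p
    rw [h] at this
    linear_combination -this⟩
  obtain ⟨s, hs⟩ := Int.eq_ofNat_of_zero_le hr0
  refine hW.cycles_le_boundaries (s := s) ?_ (by omega) (by omega)
  rw [← hs]
  exact (Int.mod_modEq l p).symm

/-- The homological reason why no string has length strictly between `stringLen p l` and `p`. If `p
∣ l`, then `s = p - 1` and nothing is to be shown; for `l ≡ -1` this is injectivity of `i_*`;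
otherwise `_1H_l = 0`. -/
theorem mem_boundaries_of_d_pow (hp : 2 ≤ p) {l : ℤ} {z : W.carrier} {s : ℕ} (hsp : s ≤ p - 1)
    (hz : z ∈ W.gr (l + s)) (hd : (W.d ^ s) z ∈ W.cycles 1 l) (hs : stringLen p l ≤ s) :
    (W.d ^ s) z ∈ W.boundaries 1 l := by
  rw [stringLen] at hs
  split_ifs at hs with hl
  · obtain rfl : s = p - 1 := le_antisymm hsp hs
    exact W.d_pow_mem_boundaries rfl (by omega) hz
  · by_cases h2 : (p : ℤ) ∣ l + 1
    · have hl' : l ≡ p - 1 [ZMOD p] := by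
        rw [Int.modEq_iff_dvd, show (p : ℤ) - 1 - l = p - (l + 1) by ring]
        exact dvd_sub_self_left.2 h2
      exact hW.mem_boundaries_one hl' hd (s := p - s) (by omega) (by omega)
        (W.d_pow_mem_boundaries (by omega) (by omega) hz)
    · exact hW.cycles_le_boundaries_of_not_dvd hp hl h2 hd

/-- A subcomplex that contains all strings of length `p` and representatives for the homology is
everything. -/
theorem eq_top_of_strings (hp : 2 ≤ p) {S : Submodule k W.carrier} (hS : ∀ x ∈ S, W.d x ∈ S)
    (hb : ∀ l, ∀ z ∈ W.boundaries 1 l, ∃ x ∈ S, x ∈ W.gr (l + ((p - 1 : ℕ) : ℤ)) ∧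
      (W.d ^ (p - 1)) x = z)
    (hc : ∀ l, ∀ z ∈ W.cycles 1 l, ∃ u ∈ S, u ∈ W.gr (l + ((stringLen p l - 1 : ℕ) : ℤ)) ∧
      (W.d ^ (stringLen p l - 1)) u - z ∈ W.boundaries 1 l) : S = ⊤ := by
  have hSpow : ∀ (r : ℕ), ∀ x ∈ S, (W.d ^ r) x ∈ S := by
    intro r
    induction r with
    | zero => exact fun x hx => hx
    | succ r ih =>
      intro x hx
      rw [pow_succ', Module.End.mul_apply]
      exact hS _ (ih x hx)
  -- Induction along the kernels of `d^s`, which exhaust `W` at `s = p`. For `z` in the kernel of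
  -- `d^{s+1}`, an element `x` of `S` with `d^s x = d^s z` reduces to `z - x` in the kernel of
  -- `d^s`.
  have key : ∀ s ≤ p, ∀ l, ∀ z ∈ W.cycles s l, z ∈ S := by
    intro s
    induction s with
    | zero =>
      intro _ l z hz
      rw [show z = 0 from (mem_cycles.1 hz).2]
      exact S.zero_mem
    | succ s ih =>
      intro hsp l z hz
      obtain ⟨l, rfl⟩ : ∃ l', l = l' + s := ⟨l - s, by ring⟩
      have hy : (W.d ^ s) z ∈ W.cycles 1 l := by
        refine mem_cycles.2 ⟨W.d_pow_mem s (by ring) hz.1, ?_⟩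
        rw [← Module.End.mul_apply, ← pow_add, add_comm]
        exact (mem_cycles.1 hz).2
      suffices ∃ x ∈ S, x ∈ W.gr (l + s) ∧ (W.d ^ s) x = (W.d ^ s) z by
        obtain ⟨x, hx, hxl, hxz⟩ := this
        have := ih (by omega) (l + s) (z - x)
          (mem_cycles.2 ⟨Submodule.sub_mem _ hz.1 hxl, by rw [map_sub, hxz, sub_self]⟩)
        simpa using S.add_mem this hx
      have hbs : ∀ b ∈ W.boundaries 1 l, ∃ x ∈ S, x ∈ W.gr (l + s) ∧ (W.d ^ s) x = b := by
        intro b hb'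
        obtain ⟨x, hx, hxl, rfl⟩ := hb l b hb'
        refine ⟨(W.d ^ (p - 1 - s)) x, hSpow _ x hx, W.d_pow_mem _ (by omega) hxl, ?_⟩
        rw [← Module.End.mul_apply, ← pow_add]
        congr 2
        omega
      -- Either `d^s z` is a boundary already, or the string representing its class is longer than
      -- `s` and has an element `s` steps before its end.
      by_cases hs : stringLen p l ≤ s
      · exact hbs _ (hW.mem_boundaries_of_d_pow hp (by omega) hz.1 hy hs)
      · obtain ⟨u, hu, hul, hub⟩ := hc l _ hy
        obtain ⟨x, hx, hxl, hxb⟩ := hbs _ hub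
        refine ⟨(W.d ^ (stringLen p l - 1 - s)) u - x, S.sub_mem (hSpow _ u hu) hx,
          Submodule.sub_mem _ (W.d_pow_mem _ (by omega) hul) hxl, ?_⟩
        rw [map_sub, hxb, ← Module.End.mul_apply, ← pow_add,
          show s + (stringLen p l - 1 - s) = stringLen p l - 1 by omega, sub_sub_cancel]
  rw [eq_top_iff]
  rintro m -
  induction m using W.homogeneous_induction with
  | h l m hm => exact key p le_rfl l m (mem_cycles.2 ⟨hm, by rw [W.d_pow]; rfl⟩)
  | hadd x y hx hy => exact S.add_mem hx hy

end HasBijectiveMaps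

theorem stringLen_pos (hp : 2 ≤ p) (l : ℤ) : 0 < stringLen p l := by
  rw [stringLen]; split_ifs <;> omega

/-- The elements `d^j x`, for `x` in a family of first elements of strings. -/
noncomputable def strings (W : PDGModule.{u, v} p n k) {β : Type w} (len : β → ℕ) (top : β → W.carrier)
    (y : Σ x, Fin (len x)) : W.carrier := (W.d ^ (y.2 : ℕ)) (top y.1)

/-- If `τ_l(v)` are the first elements of strings that end in representatives of `v ∈ _1H_l`, then
the strings for a basis of `⨁_l _1H_l`, together with the strings of length `p` for a basis of the
boundaries, form a basis. -/
theorem HasBijectiveMaps.linearIndependent_and_span_strings {W : PDGModule.{u, v} p n k}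
    (hW : W.HasBijectiveMaps) (hp : 2 ≤ p) {ι κ : ℤ → Type v}
    {z : ∀ l, ι l → W.boundaries 1 l} (hz : ∀ l, LinearIndependent k (z l))
    (hz' : ∀ l, Submodule.span k (Set.range (z l)) = ⊤)
    {ω : (Σ l, ι l) → W.carrier} (hω : ∀ x, ω x ∈ W.gr (x.1 + ((p - 1 : ℕ) : ℤ)))
    (hωd : ∀ x, (W.d ^ (p - 1)) (ω x) = z x.1 x.2)
    {e : ∀ l, κ l → W.H 1 l} (he : ∀ l, LinearIndependent k (e l))
    (he' : ∀ l, Submodule.span k (Set.range (e l)) = ⊤)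
    {τ : (Σ l, κ l) → W.carrier}
    (hτ : ∀ x, τ x ∈ W.gr (x.1 + ((stringLen p x.1 - 1 : ℕ) : ℤ)))
    (hτd : ∀ x, ∃ h, W.homClass 1 x.1 ((W.d ^ (stringLen p x.1 - 1)) (τ x)) h = e x.1 x.2) :
    LinearIndependent k (W.strings (Sum.elim (fun _ => p) fun x => stringLen p x.1)
      (Sum.elim ω τ)) ∧
    Submodule.span k (Set.range (W.strings (Sum.elim (fun _ => p) fun x => stringLen p x.1)
      (Sum.elim ω τ))) = ⊤ := by
  have hlen1 : ∀ l, 1 + (stringLen p l - 1) = stringLen p l := fun l => by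
    have := stringLen_pos hp l; omega
  choose hc hce using hτd
  have hd0 : ∀ x : Σ l, κ l, (W.d ^ stringLen p x.1) (τ x) = 0 := fun x => by
    have := (mem_cycles.1 (hc x)).2
    rwa [← Module.End.mul_apply, ← pow_add, hlen1] at this
  have hpow : ∀ (r : ℕ) (x : W.carrier),
      ((W.d.restrictScalars k : Module.End k W.carrier) ^ r) x = (W.d ^ r) x := fun r x => by
    rw [Module.End.pow_apply, Module.End.pow_apply]; rfl
  have hzc : ∀ l i, (z l i : W.carrier) ∈ W.cycles 1 l := fun l i =>
    W.boundaries_le_cycles (by omega) l (z l i).2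
  have hd0' : ∀ x, (W.d ^ (Sum.elim (fun _ => p) (fun x : Σ l, κ l => stringLen p x.1) x))
      (Sum.elim ω τ x) = 0 := by
    rintro (x | x)
    · exact W.d_pow_eq_zero le_rfl _
    · exact hd0 x
  constructor
  · have : W.strings (Sum.elim (fun _ => p) fun x => stringLen p x.1) (Sum.elim ω τ) =
        fun y => ((W.d.restrictScalars k : Module.End k W.carrier) ^ (y.2 : ℕ))
          (Sum.elim ω τ y.1) := funext fun y => (hpow _ _).symm
    rw [this]
    -- Only last elements matter. In degree `l` they are a basis of the boundaries together with
    -- representatives of a basis of `_1H_l`, hence independent.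
    refine linearIndependent_strings (W.d.restrictScalars k) _ _ ?_ ?_
    · intro x
      rw [hpow]
      exact hd0' x
    · rw [← linearIndependent_equiv (Equiv.sigmaSumDistrib ι κ)]
      refine W.linearIndependent_of_graded (fun y => ?_) fun l => ?_
      · rw [Function.comp_apply, hpow]
        obtain ⟨l, i | i⟩ := y
        · exact (hωd ⟨l, i⟩).symm ▸ (hzc l i).1
        · exact (hc ⟨l, i⟩).1
      · have hli := LinearIndependent.sumElim_of_quotient
          (M' := (W.boundaries 1 l).submoduleOf (W.cycles 1 l))
          (f := fun i => ⟨⟨z l i, hzc l i⟩, (z l i).2⟩)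
          (LinearIndependent.of_comp ((Submodule.subtype _).comp (Submodule.subtype _))
            ((hz l).map' (Submodule.subtype _) (Submodule.ker_subtype _)))
          (fun i : κ l => (⟨_, hc ⟨l, i⟩⟩ : W.cycles 1 l)) ?_
        · have hli' := hli.map' (Submodule.subtype _) (Submodule.ker_subtype _)
          convert hli' using 1
          · funext i
            rw [Function.comp_apply, hpow]
            obtain i | i := i
            · exact hωd ⟨l, i⟩
            · rfl
          · rfl
        · convert he l using 1
          · exact funext fun i => hce ⟨l, i⟩
          · rfl
  · have hmem : ∀ x (j : ℕ), (W.d ^ j) (Sum.elim ω τ x) ∈ Submodule.span k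
        (Set.range (W.strings (Sum.elim (fun _ => p) fun x => stringLen p x.1) (Sum.elim ω τ))) := by
      intro x j
      by_cases hj : j < Sum.elim (fun _ => p) (fun x : Σ l, κ l => stringLen p x.1) x
      · exact Submodule.subset_span ⟨⟨x, ⟨j, hj⟩⟩, rfl⟩
      · rw [← Nat.sub_add_cancel (not_lt.1 hj), pow_add, Module.End.mul_apply, hd0', map_zero]
        exact Submodule.zero_mem _
    refine hW.eq_top_of_strings hp ?_ ?_ ?_
    · suffices Submodule.span k _ ≤ (Submodule.span k _).comap (W.d.restrictScalars k) from
        fun x hx => this hx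
      rw [Submodule.span_le]
      rintro _ ⟨y, rfl⟩
      change W.d ((W.d ^ (y.2 : ℕ)) _) ∈ Submodule.span k _
      rw [← Module.End.mul_apply, ← pow_succ']
      exact hmem _ _
    · intro l b hb
      have hbz : (⟨b, hb⟩ : W.boundaries 1 l) ∈ Submodule.span k (Set.range (z l)) :=
        hz' l ▸ Submodule.mem_top
      have hle : Submodule.span k (Set.range (z l)) ≤ ((Submodule.span k (Set.range (W.strings
          (Sum.elim (fun _ => p) fun x => stringLen p x.1) (Sum.elim ω τ))) ⊓
          W.gr (l + ((p - 1 : ℕ) : ℤ))).map ((W.d ^ (p - 1)).restrictScalars k)).comap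
          (W.boundaries 1 l).subtype := by
        rw [Submodule.span_le]
        rintro _ ⟨i, rfl⟩
        exact ⟨ω ⟨l, i⟩, ⟨hmem (Sum.inl ⟨l, i⟩) 0, hω ⟨l, i⟩⟩, hωd ⟨l, i⟩⟩
      obtain ⟨x, ⟨h1, h2⟩, h3⟩ := hle hbz
      exact ⟨x, h1, h2, h3⟩
    · intro l b hb
      have hbz : W.homClass 1 l b hb ∈ Submodule.span k (Set.range (e l)) :=
        he' l ▸ Submodule.mem_top
      suffices ∃ u ∈ Submodule.span k (Set.range (W.strings
          (Sum.elim (fun _ => p) fun x => stringLen p x.1) (Sum.elim ω τ))),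
          u ∈ W.gr (l + ((stringLen p l - 1 : ℕ) : ℤ)) ∧
          ∃ h, W.homClass 1 l ((W.d ^ (stringLen p l - 1)) u) h = W.homClass 1 l b hb by
        obtain ⟨u, h1, h2, h, h3⟩ := this
        exact ⟨u, h1, h2, (homClass_eq_iff _ _ _).1 h3⟩
      generalize W.homClass 1 l b hb = ξ at hbz ⊢
      induction hbz using Submodule.span_induction with
      | mem ξ hξ =>
        obtain ⟨i, rfl⟩ := hξ
        exact ⟨τ ⟨l, i⟩, hmem (Sum.inr ⟨l, i⟩) 0, hτ ⟨l, i⟩, hc ⟨l, i⟩, hce ⟨l, i⟩⟩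
      | zero =>
        refine ⟨0, Submodule.zero_mem _, Submodule.zero_mem _, ?_, ?_⟩
        · rw [map_zero]; exact Submodule.zero_mem _
        · rw [homClass_eq_zero, map_zero]; exact Submodule.zero_mem _
      | add ξ η _ _ hξ hη =>
        obtain ⟨u, h1, h2, h3, rfl⟩ := hξ
        obtain ⟨u', h1', h2', h3', rfl⟩ := hη
        refine ⟨u + u', Submodule.add_mem _ h1 h1', Submodule.add_mem _ h2 h2', ?_, ?_⟩
        · rw [map_add]; exact Submodule.add_mem _ h3 h3'
        · simp only [map_add]
          rfl
      | smul a ξ _ hξ =>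
        obtain ⟨u, h1, h2, h3, rfl⟩ := hξ
        have hsm : (W.d ^ (stringLen p l - 1)) (a • u) = a • (W.d ^ (stringLen p l - 1)) u :=
          ((W.d ^ (stringLen p l - 1)).restrictScalars k).map_smul a u
        refine ⟨a • u, Submodule.smul_mem _ a h1, Submodule.smul_mem _ a h2, ?_, ?_⟩
        · rw [hsm]; exact Submodule.smul_mem _ a h3
        · simp only [hsm]
          rfl

end

end PDGModule

namespace PDGModule

section

variable {p n : ℕ} {k : Type u} [Field k]

/-! ### The relations given by the differential `d¹` -/

/-- Linearity is the point: `σ (y_i ξ)` expands in the lifts of a basis exactly as `y_i ξ` does in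
the basis, so the Loewy layer is visible on lifts. The admissible lifts form a space `T` that
surjects onto `_1H_l`, and over a field the surjection splits. -/
theorem exists_linear_section (hp : 2 ≤ p) {M : PDGModule.{u, v} p n k}
    (hW : M.fiber.HasBijectiveMaps) (l : ℤ) :
    ∃ σ : M.fiber.H 1 l →ₗ[k] M.carrier, ∀ ξ,
      σ ξ ∈ M.gr (l + ((stringLen p l - 1 : ℕ) : ℤ)) ∧
      ∃ h, M.fiber.homClass 1 l (M.fiberProj ((M.d ^ (stringLen p l - 1)) (σ ξ))) h = ξ := by
  let φ : M.carrier →ₗ[k] M.fiber.carrier :=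
    (M.fiberProj ∘ₗ (M.d ^ (stringLen p l - 1))).restrictScalars k
  let T : Submodule k M.carrier :=
    M.gr (l + ((stringLen p l - 1 : ℕ) : ℤ)) ⊓ (M.fiber.cycles 1 l).comap φ
  let f : T →ₗ[k] M.fiber.H 1 l :=
    Submodule.mkQ _ ∘ₗ (φ ∘ₗ T.subtype).codRestrict (M.fiber.cycles 1 l) fun m => m.2.2
  have hf : LinearMap.range f = ⊤ := by
    rw [LinearMap.range_eq_top]
    intro ξ
    obtain ⟨x, hx, rfl⟩ := M.fiber.exists_homClass ξ
    obtain ⟨y, hy, hb⟩ := hW.exists_string_top hp l hx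
    obtain ⟨m, hm, rfl⟩ := M.exists_fiberProj_eq hy.1
    rw [← fiberProj_d_pow] at hb
    have hmc : M.fiberProj ((M.d ^ (stringLen p l - 1)) m) ∈ M.fiber.cycles 1 l := by
      have := Submodule.add_mem _ (M.fiber.boundaries_le_cycles (by omega) l hb) hx
      rwa [sub_add_cancel] at this
    exact ⟨⟨m, hm, hmc⟩, (M.fiber.homClass_eq_iff hmc hx).2 hb⟩
  obtain ⟨g, hg⟩ := f.exists_rightInverse_of_surjective hf
  exact ⟨T.subtype ∘ₗ g, fun ξ => ⟨(g ξ).2.1, (g ξ).2.2, congrArg (fun ψ => ψ ξ) hg⟩⟩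

theorem incl_mem_augIdeal_smul (M : PDGModule.{u, v} p n k) {a : M.augSub.toPDG.carrier}
    (ha : a ∈ M.augSub.toPDG.augSubmodule) : M.augSub.incl a ∈ augIdeal n k • M.augSubmodule := by
  refine M.augSub.toPDG.augSubmodule_induction
    (P := fun a => M.augSub.incl a ∈ augIdeal n k • M.augSubmodule) ?_ ?_ a ha
  · intro f hf y
    rw [map_smul]
    exact Submodule.smul_mem_smul hf y.2
  · intro x y hx hy
    rw [map_add]
    exact Submodule.add_mem _ hx hy

/-- Turns an identity of homology classes of `IM/I²M` into a congruence modulo `I²M`; the ambiguity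
by boundaries becomes the term `d^{p-t} x` with `x ∈ IM`. -/
theorem exists_of_homClass_eq_sum_xMap (M : PDGModule.{u, v} p n k) {t : ℕ} {l l' : ℤ}
    (hl : l' = l - 1) {a : M.augSub.toPDG.carrier}
    (ha : M.augSub.toPDG.fiberProj a ∈ M.fiberOne.cycles t l') (c : k) {m : Fin n → M.carrier}
    (hm : ∀ i, M.fiberProj (m i) ∈ M.fiber.cycles t l)
    (h : M.fiberOne.homClass t l' (M.augSub.toPDG.fiberProj a) ha =
      ∑ i, M.xMap i t l l' hl (c • M.fiber.homClass t l (M.fiberProj (m i)) (hm i))) :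
    ∃ x ∈ M.gr (l' + ((p - t : ℕ) : ℤ)), x ∈ M.augSubmodule ∧
      M.augSub.incl a - c • ∑ i, (MvPolynomial.X i : MvPolynomial (Fin n) k) • m i -
        (M.d ^ (p - t)) x ∈ augIdeal n k • M.augSubmodule := by
  have hx : ∀ i, M.xFiber i (M.fiberProj (m i)) ∈ M.fiberOne.cycles t l' := fun i => by
    obtain ⟨h1, h2⟩ := mem_cycles.1 (hm i)
    subst hl
    refine mem_cycles.2 ⟨M.xFiber_mem_gr i h1, ?_⟩
    rw [d_pow_xFiber, h2, map_zero]
  have h1 : (Submodule.mkQ ((M.fiberOne.boundaries t l').submoduleOf (M.fiberOne.cycles t l')))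
      (⟨_, ha⟩ - c • ∑ i, ⟨_, hx i⟩) = 0 := by
    rw [map_sub, map_smul, map_sum, sub_eq_zero, Finset.smul_sum]
    refine h.trans (Finset.sum_congr rfl fun i _ => ?_)
    rw [map_smul]
    rfl
  rw [Submodule.mkQ_apply, Submodule.Quotient.mk_eq_zero] at h1
  obtain ⟨y, hy, hyd⟩ := mem_boundaries.1 (show _ ∈ M.fiberOne.boundaries t l' from h1)
  obtain ⟨x, hx, rfl⟩ := M.augSub.toPDG.exists_fiberProj_eq hy
  refine ⟨M.augSub.incl x, hx, x.2, ?_⟩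
  have h2 : a - c • ∑ i, M.xSub i (m i) - (M.augSub.toPDG.d ^ (p - t)) x ∈
      M.augSub.toPDG.augSubmodule := by
    rw [← fiberProj_eq_zero, map_sub, fiberProj_d_pow, sub_eq_zero]
    refine Eq.trans ?_ hyd.symm
    have hsm : M.augSub.toPDG.fiberProj (c • ∑ i, M.xSub i (m i)) =
        c • M.augSub.toPDG.fiberProj (∑ i, M.xSub i (m i)) :=
      (M.augSub.toPDG.fiberProj.restrictScalars k).map_smul c _
    rw [map_sub, hsm, map_sum]
    simp only [Submodule.subtype_apply, AddSubgroupClass.coe_sub, Submodule.coe_smul,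
      Submodule.coe_sum]
    rfl
  have h3 := M.incl_mem_augIdeal_smul h2
  have hsm : M.augSub.incl (c • ∑ i, M.xSub i (m i)) =
      c • M.augSub.incl (∑ i, M.xSub i (m i)) := (M.augSub.incl.restrictScalars k).map_smul c _
  rwa [map_sub, map_sub, hsm, map_sum, M.augSub.incl_d_pow] at h3

/-! ### The values of `d¹` as congruences modulo `I²M` -/

section Action

variable [hp : Fact p.Prime] {M : PDGModule.{u, v} p n k}
  [∀ (s : ℕ) (l : ℤ), Module (GroupAlg p n k) (M.fiber.H s l)]
  [∀ (s : ℕ) (l : ℤ), IsScalarTower k (GroupAlg p n k) (M.fiber.H s l)]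

theorem CompatibleAction.hasBijectiveMaps (hM : M.CompatibleAction) :
    M.fiber.HasBijectiveMaps := ⟨hM.i_bijective, hM.d_bijective⟩

theorem CompatibleAction.dMap_smul (hM : M.CompatibleAction) (r : ℕ) :
    ∀ (s t : ℕ) (hs : s = t + r) (_ : 1 ≤ t) (hsp : s ≤ p - 1) (l l' : ℤ) (hl : l' = l - r)
      (a : GroupAlg p n k) (ξ : M.fiber.H s l),
      M.fiber.dMap r s t hs (hsp.trans (p.sub_le 1)) l l' hl (a • ξ) =
        a • M.fiber.dMap r s t hs (hsp.trans (p.sub_le 1)) l l' hl ξ := by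
  induction r with
  | zero =>
    intro s t hs ht hsp l l' hl a ξ
    obtain rfl : s = t := hs
    obtain rfl : l' = l := by simpa using hl
    have hid : ∀ ξ : M.fiber.H s l', M.fiber.dMap 0 s s rfl (hsp.trans (p.sub_le 1)) l' l' hl ξ = ξ := by
      intro ξ
      obtain ⟨m, hm, rfl⟩ := M.fiber.exists_homClass ξ
      rfl
    rw [hid, hid]
  | succ r ih =>
    intro s t hs ht hsp l l' hl a ξ
    obtain rfl : l' = l - r - (1 : ℕ) := by rw [hl]; push_cast; ring
    have hcomp : ∀ ξ : M.fiber.H s l, M.fiber.dMap (r + 1) s t hs (hsp.trans (p.sub_le 1)) l _ hl ξ =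
        M.fiber.dMap 1 (t + 1) t rfl (by omega) (l - r) _ rfl
          (M.fiber.dMap r s (t + 1) (by omega) (hsp.trans (p.sub_le 1)) l _ rfl ξ) := by
      intro ξ
      obtain ⟨m, hm, rfl⟩ := M.fiber.exists_homClass ξ
      simp only [dMap, mapH_homClass]
      congr 1
      simp only [LinearMap.restrictScalars_apply, pow_succ', pow_zero, mul_one, Module.End.mul_apply]
    rw [hcomp, hcomp, ih s (t + 1) (by omega) (by omega) hsp, hM.d_equivariant _ t ht (by omega)]

/-- The target of `d¹` is a group `_{p-1}H`, whose boundaries are the image of `d` itself; hence the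
correction `d z`. In degrees congruent to `-2` the target is a group `_1H`, and the correction
becomes `d^{p-1} z`. -/
theorem CompatibleAction.exists_of_modEq_neg_one (hM : M.CompatibleAction) {l : ℤ}
    (hl : l ≡ p - 1 [ZMOD p]) {x : M.carrier} (hx : x ∈ M.gr l)
    (hxc : M.fiberProj x ∈ M.fiber.cycles 1 l) {m : Fin n → M.carrier}
    (hm : ∀ i, M.fiberProj (m i) ∈ M.fiber.cycles 1 l)
    (h : ∀ i, M.fiber.homClass 1 l _ (hm i) = yElt p n k i • M.fiber.homClass 1 l _ hxc) :
    ∃ z ∈ M.gr (l - 1 + 1), z ∈ M.augSubmodule ∧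
      (M.d ^ 1) x - ∑ i, (MvPolynomial.X i : MvPolynomial (Fin n) k) • m i - (M.d ^ 1) z ∈
        augIdeal n k • M.augSubmodule := by
  have hp2 := hp.out.two_le
  have hd : (M.d ^ 1) x ∈ M.augSub.toSubmodule := by
    rw [← M.augSub.proj_eq_zero]
    exact (M.augSub.proj_d_pow 1 x).trans (mem_cycles.1 hxc).2
  have h1 := hM.dOne_of_neg_one l hl x hx hd
  have hm' : ∀ i, M.fiberProj (m i) ∈ M.fiber.cycles (p - 1) l := fun i =>
    M.fiber.cycles_mono (by omega) l (hm i)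
  have hc : M.augSub.toPDG.fiberProj ⟨(M.d ^ 1) x, hd⟩ ∈ M.fiberOne.cycles (p - 1) (l - (1 : ℕ)) := by
    refine mem_cycles.2 ⟨M.augSub.toPDG.fiberProj_mem_gr (M.d_pow_mem 1 rfl hx), ?_⟩
    refine (M.augSub.toPDG.fiberProj_d_pow (p - 1) _).symm.trans ?_
    have h0 : (M.augSub.toPDG.d ^ (p - 1)) ⟨(M.d ^ 1) x, hd⟩ = 0 := by
      refine Subtype.ext ((M.augSub.incl_d_pow (p - 1) ⟨(M.d ^ 1) x, hd⟩).trans ?_)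
      change (M.d ^ (p - 1)) ((M.d ^ 1) x) = 0
      rw [← Module.End.mul_apply, ← pow_add]
      exact M.d_pow_eq_zero (by omega) _
    rw [h0]
    exact map_zero _
  obtain ⟨z, hz, hzI, hzd⟩ := M.exists_of_homClass_eq_sum_xMap (t := p - 1) (l := l) rfl hc 1 hm' (by
    refine Eq.trans h1 (Finset.sum_congr rfl fun i _ => congrArg _ ?_)
    rw [one_smul]
    refine Eq.trans (congrArg _ (h i).symm) ?_
    rfl)
  rw [show p - (p - 1) = 1 by omega] at hz hzd
  rw [one_smul] at hzd
  exact ⟨z, hz, hzI, hzd⟩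

theorem CompatibleAction.exists_of_modEq_neg_two (hM : M.CompatibleAction) {l : ℤ}
    (hl : l ≡ p - 2 [ZMOD p]) {x : M.carrier} (hx : x ∈ M.gr l)
    (hxc : M.fiberProj ((M.d ^ (p - 2)) x) ∈ M.fiber.cycles 1 (l - (p - 2 : ℕ)))
    {m : Fin n → M.carrier}
    (hm : ∀ i, M.fiberProj (m i) ∈ M.fiber.cycles 1 (l - (p - 2 : ℕ)))
    (h : ∀ i, M.fiber.homClass 1 (l - (p - 2 : ℕ)) _ (hm i) =
      yElt p n k i • M.fiber.homClass 1 (l - (p - 2 : ℕ)) _ hxc) :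
    ∃ z ∈ M.gr (l - (p - 1 : ℕ) + (p - 1 : ℕ)), z ∈ M.augSubmodule ∧
      (M.d ^ (p - 1)) x - ((p : k) - 1) • ∑ i, (MvPolynomial.X i : MvPolynomial (Fin n) k) • m i -
        (M.d ^ (p - 1)) z ∈ augIdeal n k • M.augSubmodule := by
  have hp2 := hp.out.two_le
  have hd : (M.d ^ (p - 1)) x ∈ M.augSub.toSubmodule := by
    rw [← M.augSub.proj_eq_zero, show p - 1 = 1 + (p - 2) by omega, pow_add, Module.End.mul_apply]
    exact (M.augSub.proj_d_pow 1 _).trans (mem_cycles.1 hxc).2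
  have h1 := hM.dOne_of_neg_two l hl x hx hd
  have hc : M.augSub.toPDG.fiberProj ⟨(M.d ^ (p - 1)) x, hd⟩ ∈
      M.fiberOne.cycles 1 (l - (p - 1 : ℕ)) := by
    refine mem_cycles.2 ⟨M.augSub.toPDG.fiberProj_mem_gr (M.d_pow_mem (p - 1) rfl hx), ?_⟩
    refine (M.augSub.toPDG.fiberProj_d_pow 1 _).symm.trans ?_
    have h0 : (M.augSub.toPDG.d ^ 1) ⟨(M.d ^ (p - 1)) x, hd⟩ = 0 := by
      refine Subtype.ext ((M.augSub.incl_d_pow 1 ⟨(M.d ^ (p - 1)) x, hd⟩).trans ?_)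
      change (M.d ^ 1) ((M.d ^ (p - 1)) x) = 0
      rw [← Module.End.mul_apply, ← pow_add]
      exact M.d_pow_eq_zero (by omega) _
    rw [h0]
    exact map_zero _
  refine M.exists_of_homClass_eq_sum_xMap (t := 1) (l := l - (p - 2 : ℕ)) (by omega) hc
    ((p : k) - 1) hm ?_
  refine Eq.trans h1 (Finset.sum_congr rfl fun i _ => congrArg _ ?_)
  rw [hM.dMap_smul _ _ _ _ le_rfl le_rfl, h i, smul_assoc]
  congr 2
  exact (M.fiber.homClass_eq_iff _ _).2 (by
    rw [fiberProj_d_pow]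
    exact (congrArg (· ∈ M.fiber.boundaries 1 _)
      (sub_self ((M.fiber.d ^ (p - 2)) (M.fiberProj x)))).mpr (Submodule.zero_mem _))

end Action

end

end PDGModule

/-- Counting the larger elements maps `S` injectively, hence bijectively, to the numbers below its
cardinality. This numbers the stages without gaps. -/
theorem Finset.exists_card_filter_lt_eq {K : Type u} [LinearOrder K] (S : Finset K) {r : ℕ}
    (hr : r < S.card) : ∃ a ∈ S, (S.filter (a < ·)).card = r := by
  have hanti : ∀ a ∈ S, ∀ b ∈ S, a < b → (S.filter (b < ·)).card < (S.filter (a < ·)).card :=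
    fun a _ b hb hab => Finset.card_lt_card (Finset.ssubset_iff_of_subset
      (Finset.monotone_filter_right _ fun c _ hc => hab.trans hc) |>.2
      ⟨b, Finset.mem_filter.2 ⟨hb, hab⟩, fun h => (Finset.mem_filter.1 h).2.false⟩)
  have hinj : Set.InjOn (fun a => (S.filter (a < ·)).card) S := by
    intro a ha b hb hab
    by_contra hne
    rcases lt_or_gt_of_ne hne with h | h
    · exact (hanti a ha b hb h).ne hab.symm
    · exact (hanti b hb a ha h).ne hab
  have hmaps : Set.MapsTo (fun a => (S.filter (a < ·)).card) S (Finset.range S.card) := by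
    intro a ha
    simp only [Finset.coe_range, Set.mem_Iio]
    exact Finset.card_lt_card (Finset.filter_ssubset.2 ⟨a, ha, lt_irrefl a⟩)
  obtain ⟨a, ha, h⟩ := Finset.surjOn_of_injOn_of_card_le _ hmaps hinj (by simp)
    (Finset.mem_coe.2 (Finset.mem_range.2 hr))
  exact ⟨a, ha, h⟩

namespace PDGModule

section

variable {p n : ℕ} {k : Type u} [Field k]

/-! ### Filtering the strings by degree and rank -/

/-- The stage of a string is the number of occupied pairs (last degree, rank) lexicographically
above its own, so `hd` says that `d` leads to earlier stages. Strings of equal stage have equal last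
degree and thus equal length, and `hL` puts `L l` occupied pairs over `l`. -/
theorem hasCompositionSeries_of_rank (hp : 2 ≤ p) {N : PDGModule.{u, v} p n k} {β : Type v}
    [Finite β] {bot : β → ℤ} {top : β → N.carrier} {c : β → ℤ} (htop : ∀ x, top x ∈ N.gr (c x))
    (b : Module.Basis (Σ x, Fin (stringLen p (bot x))) (MvPolynomial (Fin n) k) N.carrier)
    (hb : ∀ y, b y = (N.d ^ (y.2 : ℕ)) (top y.1)) {rk : β → ℕ} {L : ℤ → ℕ}
    (hL : ∀ l r, (∃ x, bot x = l ∧ rk x = r) ↔ r < L l)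
    (hd : ∀ x, (N.d ^ stringLen p (bot x)) (top x) ∈ Submodule.span (MvPolynomial (Fin n) k)
      (b '' {y | bot x < bot y.1 ∨ bot y.1 = bot x ∧ rk x < rk y.1})) :
    N.HasCompositionSeries (∑ᶠ l, L l) := by
  classical
  have := Fintype.ofFinite β
  let key : β → ℤ ×ₗ ℕ := fun x => toLex (bot x, rk x)
  let S : Finset (ℤ ×ₗ ℕ) := Finset.univ.image key
  have hkS : ∀ x, key x ∈ S := fun x => Finset.mem_image_of_mem key (Finset.mem_univ x)
  have hcard : S.card = ∑ᶠ l, L l := by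
    rw [finsum_eq_sum_of_support_subset (s := Finset.univ.image bot) L]
    · rw [Finset.card_eq_sum_card_fiberwise (f := fun κ => (ofLex κ).1)
        (t := Finset.univ.image bot)]
      · refine Finset.sum_congr rfl fun l _ => ?_
        rw [← Finset.card_range (L l), ← Finset.card_image_of_injective (Finset.range (L l))
          (f := fun r => toLex (l, r)) (fun r r' h => (Prod.mk.inj (toLex.injective h)).2)]
        congr 1
        ext κ
        simp only [S, key, Finset.mem_filter, Finset.mem_image, Finset.mem_univ, true_and,
          Finset.mem_range, ← hL]
        constructor
        · rintro ⟨⟨x, rfl⟩, hx⟩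
          exact ⟨rk x, ⟨x, hx, rfl⟩, by rw [← hx]; rfl⟩
        · rintro ⟨_, ⟨x, rfl, rfl⟩, rfl⟩
          exact ⟨⟨x, rfl⟩, rfl⟩
      · rintro κ hκ
        obtain ⟨x, -, rfl⟩ := Finset.mem_image.1 hκ
        exact Finset.mem_coe.2 (Finset.mem_image_of_mem bot (Finset.mem_univ x))
    · intro l hl
      obtain ⟨x, hx, -⟩ := (hL l 0).2 (Nat.pos_of_ne_zero hl)
      exact Finset.mem_coe.2 (Finset.mem_image.2 ⟨x, Finset.mem_univ x, hx⟩)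
  let stage : β → ℕ := fun x => (S.filter (key x < ·)).card
  have hstage : ∀ x y, key x < key y → stage y < stage x := fun x y hxy =>
    Finset.card_lt_card (Finset.ssubset_iff_of_subset
      (Finset.monotone_filter_right _ fun c _ hc => hxy.trans hc) |>.2
      ⟨key y, Finset.mem_filter.2 ⟨hkS y, hxy⟩, fun h => (Finset.mem_filter.1 h).2.false⟩)
  have hkey : ∀ x y, stage x = stage y → key x = key y := by
    intro x y hxy
    by_contra hne
    rcases lt_or_gt_of_ne hne with h | h
    · exact (hstage x y h).ne hxy.symm
    · exact (hstage y x h).ne hxy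
  rw [← hcard]
  refine hasCompositionSeries_of_stages hp htop b hb stage (fun x => ?_) _ (fun x => ?_)
    fun r hr => ?_
  · refine Submodule.span_mono (Set.image_mono ?_) (hd x)
    intro y hy
    refine hstage x y.1 (Prod.Lex.toLex_lt_toLex.2 ?_)
    exact hy.imp id fun h => ⟨h.1.symm, h.2⟩
  · exact Finset.card_lt_card (Finset.filter_ssubset.2 ⟨key x, hkS x, lt_irrefl _⟩)
  · obtain ⟨a, ha, har⟩ := S.exists_card_filter_lt_eq hr
    obtain ⟨x, -, rfl⟩ := Finset.mem_image.1 ha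
    refine ⟨⟨x, har⟩, stringLen p (bot x), ?_, fun y hy => ?_⟩
    · rw [stringLen]; split_ifs <;> simp
    · have := congrArg (fun κ => (ofLex κ).1) (hkey y x (hy.trans har.symm))
      exact congrArg (stringLen p) this

/-- If two strings have admissible last degrees and one of them meets the last degree of the other,
then its own last degree is not smaller. -/
theorem le_of_le_add_stringLen (hp : 2 ≤ p) {a c : ℤ} (hc : (p : ℤ) ∣ c ∨ (p : ℤ) ∣ c + 1) {j : ℕ}
    (h : c ≤ a + ((stringLen p a - 1 : ℕ) : ℤ) - j) : c ≤ a := by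
  by_contra! hlt
  rw [stringLen] at h
  split_ifs at h with ha
  · rcases hc with hc | hc
    · have := Int.le_of_dvd (by omega) (dvd_sub hc ha)
      omega
    · have := Int.le_of_dvd (by omega) (dvd_sub hc ha)
      omega
  · omega

theorem _root_.Submodule.span_image_setOf_mono {R : Type u} {V : Type v} [Semiring R]
    [AddCommMonoid V] [Module R V] {ι : Type w} (b : ι → V) {P Q : ι → Prop}
    (h : ∀ y, P y → Q y) : Submodule.span R (b '' {y | P y}) ≤ Submodule.span R (b '' {y | Q y}) :=
  Submodule.span_mono (Set.image_mono h)

/-! ### Triangularity of the differential with respect to last degree and rank -/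

section Rank

variable {N : PDGModule.{u, v} p n k} {β : Type v} {bot : β → ℤ} {top : β → N.carrier}
  (hp : 2 ≤ p) (hbot : ∀ x, (p : ℤ) ∣ bot x ∨ (p : ℤ) ∣ bot x + 1)
  (htop : ∀ x, top x ∈ N.gr (bot x + ((stringLen p (bot x) - 1 : ℕ) : ℤ)))
  (b : Module.Basis (Σ x, Fin (stringLen p (bot x))) (MvPolynomial (Fin n) k) N.carrier)
  (hb : ∀ y, b y = (N.d ^ (y.2 : ℕ)) (top y.1))
  (hI : ∀ x, (N.d ^ stringLen p (bot x)) (top x) ∈ N.augSubmodule)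

include hb in
theorem d_basis_of_lt (y : Σ x, Fin (stringLen p (bot x)))
    (hj : (y.2 : ℕ) + 1 < stringLen p (bot y.1)) : N.d (b y) = b ⟨y.1, ⟨y.2 + 1, hj⟩⟩ := by
  rw [hb, hb, ← Module.End.mul_apply, ← pow_succ']

include htop hb in
theorem basis_mem_gr (y : Σ x, Fin (stringLen p (bot x))) :
    b y ∈ N.gr (bot y.1 + ((stringLen p (bot y.1) - 1 : ℕ) : ℤ) - (y.2 : ℕ)) := by
  rw [hb]; exact N.d_pow_mem _ rfl (htop _)

include hp hbot htop hb hI in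
-- An element of `IN` of degree `bot x - 1` involves only basis elements of degree at least `bot x`,
-- and these belong to strings ending in degree at least `bot x`.
theorem d_pow_top_mem_span_le (x : β) : (N.d ^ stringLen p (bot x)) (top x) ∈
    Submodule.span (MvPolynomial (Fin n) k) (b '' {y | bot x ≤ bot y.1}) := by
  have hlen := stringLen_pos hp (bot x)
  have h := mem_span_of_mem_augSubmodule (basis_mem_gr htop b hb) b.span_eq (l := bot x - 1)
    (N.d_pow_mem _ (by omega) (htop x)) (hI x)
  refine Submodule.span_image_setOf_mono b (fun y hy => ?_) h
  rw [sub_add_cancel] at hy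
  exact le_of_le_add_stringLen hp (hbot x) hy

include hp hbot htop hb hI in
theorem d_pow_mem_span_lt (l : ℤ) (r : ℕ) {m : N.carrier}
    (hm : m ∈ Submodule.span (MvPolynomial (Fin n) k) (b '' {y | l < bot y.1})) :
    (N.d ^ r) m ∈ Submodule.span (MvPolynomial (Fin n) k) (b '' {y | l < bot y.1}) := by
  obtain ⟨F, hF⟩ := exists_sub_span htop b hb {x | l < bot x} (by
    intro x hx
    refine Submodule.span_image_setOf_mono b ?_ (d_pow_top_mem_span_le hp hbot htop b hb hI x)
    intro y hy
    exact lt_of_lt_of_le (Set.mem_ofPred.1 hx) hy)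
  have hF' : F.toSubmodule = Submodule.span (MvPolynomial (Fin n) k) (b '' {y | l < bot y.1}) := hF
  rw [← hF'] at hm ⊢
  induction r with
  | zero => exact hm
  | succ r ih =>
    rw [pow_succ', Module.End.mul_apply]
    exact F.d_mem _ ih

include hp hbot htop hb hI in
/-- An element that involves no last elements of the strings ending in degree `l` is determined by
its differential, up to strings ending in higher degrees. -/
theorem mem_span_of_d_mem_span (l : ℤ) (t : Set β) {m : N.carrier}
    (hm : m ∈ Submodule.span (MvPolynomial (Fin n) k)
      (b '' {y | l < bot y.1 ∨ bot y.1 = l ∧ (y.2 : ℕ) + 2 ≤ stringLen p (bot y.1)}))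
    (hd : N.d m ∈ Submodule.span (MvPolynomial (Fin n) k)
      (b '' {y | l < bot y.1 ∨ bot y.1 = l ∧ y.1 ∈ t})) :
    m ∈ Submodule.span (MvPolynomial (Fin n) k)
      (b '' {y | l < bot y.1 ∨ bot y.1 = l ∧ y.1 ∈ t}) := by
  classical
  -- Modulo strings ending above `l`, `d` sends each non-last basis element to the next one of its
  -- string; the coefficients of `m` reappear, shifted, in `d m`.
  have hrepr : ∀ y : Σ x, Fin (stringLen p (bot x)), bot y.1 = l →
      ∀ hj : (y.2 : ℕ) + 1 < stringLen p (bot y.1),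
      b.repr (N.d m) ⟨y.1, ⟨y.2 + 1, hj⟩⟩ = b.repr m y := by
    intro y hy hj
    clear hd
    induction hm using Submodule.closure_induction with
    | zero => simp
    | add m m' _ _ h h' => simp only [map_add, Finsupp.add_apply, h, h']
    | smul_mem a m hm =>
      obtain ⟨z, hz, rfl⟩ := hm
      simp only [map_smul, Finsupp.smul_apply]
      congr 1
      rcases hz with hz | ⟨hz, hzj⟩
      · have h1 := d_pow_mem_span_lt hp hbot htop b hb hI l 1
          (Submodule.subset_span (Set.mem_image_of_mem b hz))
        rw [pow_one, Module.Basis.mem_span_image] at h1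
        have h2 : y ≠ z := fun h => (show l < bot z.1 from hz).ne' (h ▸ hy)
        rw [b.repr_self z, Finsupp.single_eq_of_ne h2]
        refine Finsupp.notMem_support_iff.1 fun h => ?_
        have h3 := h1 h
        exact (show l < bot y.1 from h3).ne' hy
      · rw [d_basis_of_lt b hb z hzj, b.repr_self, b.repr_self, Finsupp.single_apply,
          Finsupp.single_apply]
        refine if_congr ?_ rfl rfl
        obtain ⟨x, j⟩ := y
        obtain ⟨x', j'⟩ := z
        simp only [Sigma.mk.injEq]
        refine and_congr_right fun h => ?_
        subst h
        simp [Fin.ext_iff]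
  rw [Module.Basis.mem_span_image] at hm hd ⊢
  intro y hy
  rcases hm hy with h | ⟨h, hj⟩
  · exact Or.inl h
  · refine Or.inr ⟨h, ?_⟩
    have hy' : (⟨y.1, ⟨y.2 + 1, hj⟩⟩ : Σ x, Fin (stringLen p (bot x))) ∈ (b.repr (N.d m)).support := by
      rw [Finsupp.mem_support_iff, hrepr y h hj]
      exact Finsupp.mem_support_iff.1 hy
    rcases hd hy' with h' | h'
    · exact absurd h (show l < bot y.1 from h').ne'
    · exact h'.2

include hp hbot htop hb hI in
-- Descending induction on the rank. The term with `w` has the required form, and by degree the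
-- errors leave only strings ending above and non-last elements of strings with the same end. For
-- length `1` there are no such elements. For length `p - 1`, put `m = d^{p-1} (top x) - d^{p-2} w`:
-- then `d m = -d^{p-1} w` because `d^p = 0`, the induction hypothesis controls the right side, and
-- `mem_span_of_d_mem_span` recovers `m`.
theorem d_pow_top_mem_span_rank {rk : β → ℕ} {R : ℕ} (hR : ∀ x, rk x ≤ R)
    (hrel : ∀ x, ∃ w ∈ Submodule.span (MvPolynomial (Fin n) k)
        (top '' {y | bot y = bot x ∧ rk x < rk y}),
      w ∈ N.gr (bot x + ((stringLen p (bot x) - 1 : ℕ) : ℤ) - 1) ∧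
      ∃ z ∈ N.gr (bot x - 1 + (stringLen p (bot x) : ℕ)), z ∈ N.augSubmodule ∧
        (N.d ^ stringLen p (bot x)) (top x) - (N.d ^ (stringLen p (bot x) - 1)) w -
          (N.d ^ stringLen p (bot x)) z ∈ augIdeal n k • N.augSubmodule) :
    ∀ x, (N.d ^ stringLen p (bot x)) (top x) ∈ Submodule.span (MvPolynomial (Fin n) k)
      (b '' {y | bot x < bot y.1 ∨ bot y.1 = bot x ∧ rk x < rk y.1}) := by
  suffices ∀ (q : ℕ) (x : β), R ≤ rk x + q → (N.d ^ stringLen p (bot x)) (top x) ∈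
      Submodule.span (MvPolynomial (Fin n) k)
        (b '' {y | bot x < bot y.1 ∨ bot y.1 = bot x ∧ rk x < rk y.1}) from
    fun x => this R x (Nat.le_add_left _ _)
  intro q
  induction q using Nat.strong_induction_on with
  | h q ih =>
  intro x hx
  obtain ⟨w, hw, hwgr, z, hz, hzI, hrem⟩ := hrel x
  have hlen := stringLen_pos hp (bot x)
  set l := bot x with hl
  have htx : top x ∈ N.gr (l + ((stringLen p l - 1 : ℕ) : ℤ)) := htop x
  -- Basis elements occurring in `z ∈ IN` have degree at least `l + stringLen p l`, which exceeds
  -- every degree in a string ending in `l`.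
  have hz' : z ∈ Submodule.span (MvPolynomial (Fin n) k) (b '' {y | l < bot y.1}) := by
    refine Submodule.span_image_setOf_mono b (fun y hy => ?_)
      (mem_span_of_mem_augSubmodule (basis_mem_gr htop b hb) b.span_eq hz hzI)
    refine lt_of_le_of_ne (le_of_le_add_stringLen (j := y.2) hp (hbot x) (by omega)) fun h => ?_
    have := congrArg (stringLen p) h
    omega
  have hzd := d_pow_mem_span_lt hp hbot htop b hb hI l (stringLen p l) hz'
  have hrem' : (N.d ^ stringLen p l) (top x) - (N.d ^ (stringLen p l - 1)) w -
      (N.d ^ stringLen p l) z ∈ Submodule.span (MvPolynomial (Fin n) k)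
      (b '' {y | l < bot y.1 ∨ bot y.1 = l ∧ (y.2 : ℕ) + 2 ≤ stringLen p (bot y.1)}) := by
    have hgr : (N.d ^ stringLen p l) (top x) - (N.d ^ (stringLen p l - 1)) w -
        (N.d ^ stringLen p l) z ∈ N.gr (l - 1) :=
      Submodule.sub_mem _ (Submodule.sub_mem _ (N.d_pow_mem _ (by omega) htx)
        (N.d_pow_mem _ (by omega) hwgr)) (N.d_pow_mem _ (by omega) hz)
    -- The remainder lies in `I²N`, so only degrees at least `l + 1` occur; this excludes the last
    -- elements in degree `l`.
    refine Submodule.span_image_setOf_mono b (fun y hy => ?_)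
      (mem_span_of_mem_augIdeal_smul_augSubmodule (basis_mem_gr htop b hb) b.span_eq hgr hrem)
    rcases (le_of_le_add_stringLen (j := y.2) hp (hbot x) (by omega) : l ≤ bot y.1).lt_or_eq with
      h | h
    · exact Or.inl h
    · refine Or.inr ⟨h.symm, ?_⟩
      have := congrArg (stringLen p) h
      omega
  set m := (N.d ^ stringLen p l) (top x) - (N.d ^ (stringLen p l - 1)) w with hm
  have hmE : m ∈ Submodule.span (MvPolynomial (Fin n) k)
      (b '' {y | l < bot y.1 ∨ bot y.1 = l ∧ (y.2 : ℕ) + 2 ≤ stringLen p (bot y.1)}) := by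
    have := Submodule.add_mem _ hrem' (Submodule.span_image_setOf_mono b
      (fun y hy => Or.inl hy) hzd)
    rwa [sub_add_cancel] at this
  have hwd : (N.d ^ (stringLen p l - 1)) w ∈ Submodule.span (MvPolynomial (Fin n) k)
      (b '' {y | l < bot y.1 ∨ bot y.1 = l ∧ rk x < rk y.1}) := by
    have := Submodule.mem_map_of_mem (f := N.d ^ (stringLen p l - 1)) hw
    rw [Submodule.map_span] at this
    refine Submodule.span_le.2 ?_ this
    rintro _ ⟨_, ⟨y, ⟨hy1, hy2⟩, rfl⟩, rfl⟩
    exact Submodule.subset_span ⟨⟨y, ⟨stringLen p l - 1, by rw [hy1]; omega⟩⟩,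
      Or.inr ⟨hy1, hy2⟩, hb _⟩
  suffices m ∈ Submodule.span (MvPolynomial (Fin n) k)
      (b '' {y | l < bot y.1 ∨ bot y.1 = l ∧ rk x < rk y.1}) by
    have := Submodule.add_mem _ this hwd
    rwa [hm, sub_add_cancel] at this
  by_cases h1 : stringLen p l = 1
  · refine Submodule.span_image_setOf_mono b (fun y hy => ?_) hmE
    rcases hy with h | ⟨h, h'⟩
    · exact Or.inl h
    · have := congrArg (stringLen p) h
      omega
  · have hlp : stringLen p l + 1 = p := by
      rw [stringLen] at h1 ⊢
      split_ifs at h1 ⊢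
      · omega
      · exact absurd rfl h1
    refine mem_span_of_d_mem_span hp hbot htop b hb hI l {y | rk x < rk y} hmE ?_
    rw [hm, map_sub, ← Module.End.mul_apply, ← Module.End.mul_apply, ← pow_succ', ← pow_succ',
      hlp, N.d_pow, LinearMap.zero_apply, zero_sub, Nat.sub_add_cancel hlen]
    refine Submodule.neg_mem _ ?_
    have := Submodule.mem_map_of_mem (f := N.d ^ stringLen p l) hw
    rw [Submodule.map_span] at this
    refine Submodule.span_le.2 ?_ this
    rintro _ ⟨_, ⟨y, ⟨hy1, hy2⟩, rfl⟩, rfl⟩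
    have hq := hR y
    have := ih (R - rk y) (by omega) y (by omega)
    rw [hy1] at this
    refine Submodule.span_image_setOf_mono b (fun y' hy' => ?_) this
    rcases hy' with h | ⟨h, h'⟩
    · exact Or.inl h
    · exact Or.inr ⟨h, hy2.trans h'⟩

end Rank

end

end PDGModule

/-! ### Bases adapted to a filtration -/

/-- A vector space with a finite exhaustive filtration has a basis adapted to the filtration. -/
theorem exists_adapted_set {K : Type u} {V : Type v} [Field K] [AddCommGroup V] [Module K V]
    {F : ℕ → Submodule K V} (hF : Antitone F) (h0 : F 0 = ⊤) {L : ℕ} (hL : F L = ⊥) :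
    ∃ s : Set V, LinearIndepOn K id s ∧ Submodule.span K s = ⊤ ∧
      (∀ r, Submodule.span K (s ∩ F r) = F r) ∧
      ∃ rk : s → ℕ, ∀ (b : s) r, (b : V) ∈ F r ↔ r ≤ rk b := by
  classical
  -- Built from the zero end: a basis of `F (L - q)` is extended inside the next larger subspace.
  have key : ∀ q ≤ L, ∃ s ⊆ (F (L - q) : Set V), LinearIndepOn K id s ∧
      ∀ r, L - q ≤ r → Submodule.span K (s ∩ F r) = F r := by
    intro q
    induction q with
    | zero =>
      refine fun _ => ⟨∅, Set.empty_subset _, linearIndependent_empty K V, fun r hr => ?_⟩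
      have : F r = ⊥ := le_bot_iff.1 (hL ▸ hF (by simpa using hr))
      simp [this]
    | succ q ih =>
      intro hq
      obtain ⟨s, hs, hli, hspan⟩ := ih (by omega)
      obtain ⟨b, hb, hsb, htb, hbli⟩ := exists_linearIndepOn_id_extension hli
        (t := (F (L - (q + 1)) : Set V)) (hs.trans (hF (by omega)))
      refine ⟨b, hb, hbli, fun r hr => le_antisymm (Submodule.span_le.2 Set.inter_subset_right) ?_⟩
      rcases hr.eq_or_lt with rfl | hr
      · rw [Set.inter_eq_left.2 hb]
        exact htb
      · refine (hspan r (by omega)).ge.trans (Submodule.span_mono (Set.inter_subset_inter_left _ hsb))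
  obtain ⟨s, -, hli, hspan⟩ := key L le_rfl
  have hspan' : ∀ r, Submodule.span K (s ∩ F r) = F r := fun r => hspan r (by simp)
  have hex : ∀ b : s, ∃ r, (b : V) ∉ F (r + 1) := fun b => ⟨L, fun h => by
    have h' := hF (Nat.le_succ L) h
    rw [hL] at h'
    exact hli.ne_zero b.2 ((Submodule.mem_bot K).1 h')⟩
  -- The rank is the last index `r` with `b ∈ F r`. It exists because a basis element is nonzero and
  -- `F L = ⊥`.
  refine ⟨s, hli, ?_, hspan', fun b => Nat.find (hex b), fun (b : s) r => ⟨fun h => ?_, fun h => ?_⟩⟩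
  · have := hspan' 0
    rwa [h0, Submodule.top_coe, Set.inter_univ] at this
  · by_contra! hlt
    exact Nat.find_spec (hex b) (hF hlt h)
  · cases r with
    | zero => rw [h0]; trivial
    | succ r => exact not_not.1 (Nat.find_min (hex b) h)

/-! ### Loewy lengths -/

/-- Frobenius: `(e_i - 1)^p = e_i^p - 1 = 0`. This makes `J` nilpotent. -/
theorem yElt_pow (p n : ℕ) [Fact p.Prime] (k : Type u) [Field k] [CharP k p] (i : Fin n) :
    yElt p n k i ^ p = 0 := by
  have : CharP (GroupAlg p n k) p :=
    charP_of_injective_algebraMap (algebraMap k (GroupAlg p n k)).injective p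
  rw [yElt, sub_pow_char, one_pow, ← map_pow, ← ofAdd_nsmul, ← Pi.single_smul]
  simp [MonoidAlgebra.one_def]

theorem exists_groupAugIdeal_pow_eq_bot (p n : ℕ) [Fact p.Prime] (k : Type u) [Field k]
    [CharP k p] : ∃ r, groupAugIdeal p n k ^ r = ⊥ := by
  have hfg : (groupAugIdeal p n k).FG := ⟨Set.Finite.toFinset (Set.finite_range (yElt p n k)), by
    rw [Set.Finite.coe_toFinset]; rfl⟩
  refine (Ideal.FG.isNilpotent_iff_le_nilradical hfg).2 ?_
  rw [groupAugIdeal, Ideal.span_le]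
  rintro _ ⟨i, rfl⟩
  exact ⟨p, yElt_pow p n k i⟩

section Loewy

variable (p n : ℕ) (k : Type u) [Field k] (V : Type v) [AddCommGroup V]
  [Module k V] [Module (GroupAlg p n k) V] [IsScalarTower k (GroupAlg p n k) V]

/-- The Loewy filtration `J^r V` as a filtration by `k`-subspaces. -/
noncomputable def loewyFiltration (r : ℕ) : Submodule k V :=
  (groupAugIdeal p n k ^ r • (⊤ : Submodule (GroupAlg p n k) V)).restrictScalars k

theorem loewyFiltration_antitone : Antitone (loewyFiltration p n k V) := by
  intro r s h v hv
  have hle : groupAugIdeal p n k ^ s • (⊤ : Submodule (GroupAlg p n k) V) ≤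
      groupAugIdeal p n k ^ r • ⊤ := Submodule.smul_mono_left (Ideal.pow_le_pow_right h)
  exact hle hv

theorem loewyFiltration_zero : loewyFiltration p n k V 0 = ⊤ := by
  rw [loewyFiltration, pow_zero, Ideal.one_eq_top, Submodule.top_smul]
  rfl

theorem yElt_smul_mem (i : Fin n) {r : ℕ} {v : V} (hv : v ∈ loewyFiltration p n k V r) :
    yElt p n k i • v ∈ loewyFiltration p n k V (r + 1) := by
  change _ ∈ groupAugIdeal p n k ^ (r + 1) • (⊤ : Submodule (GroupAlg p n k) V)
  rw [pow_succ', Submodule.mul_smul]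
  exact Submodule.smul_mem_smul (Ideal.subset_span ⟨i, rfl⟩) hv

variable [Fact p.Prime] [CharP k p]

theorem loewyFiltration_loewyLength : loewyFiltration p n k V (loewyLength p n k V) = ⊥ := by
  have hne : {r : ℕ | groupAugIdeal p n k ^ r • (⊤ : Submodule (GroupAlg p n k) V) = ⊥}.Nonempty := by
    obtain ⟨r, hr⟩ := exists_groupAugIdeal_pow_eq_bot p n k
    exact ⟨r, by rw [Set.mem_ofPred_eq, hr, Submodule.bot_smul]⟩
  have h : groupAugIdeal p n k ^ loewyLength p n k V • (⊤ : Submodule (GroupAlg p n k) V) = ⊥ :=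
    Nat.sInf_mem hne
  rw [loewyFiltration, h]
  rfl

/-- Once `J^r V = J^{r+1} V`, the filtration is constant from `r` on; nilpotence of `J` makes it
zero there, against the minimality of the Loewy length. -/
theorem loewyFiltration_succ_ne {r : ℕ} (hr : r < loewyLength p n k V) :
    ¬ loewyFiltration p n k V r ≤ loewyFiltration p n k V (r + 1) := by
  intro h
  have h1 : groupAugIdeal p n k ^ r • (⊤ : Submodule (GroupAlg p n k) V) ≤
      groupAugIdeal p n k ^ (r + 1) • ⊤ := h
  have hstab : ∀ q, groupAugIdeal p n k ^ r • (⊤ : Submodule (GroupAlg p n k) V) ≤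
      groupAugIdeal p n k ^ (r + q) • ⊤ := by
    intro q
    induction q with
    | zero => exact le_rfl
    | succ q ih =>
      refine h1.trans ?_
      have := Submodule.smul_mono (le_refl (groupAugIdeal p n k)) ih
      rwa [← Submodule.mul_smul, ← Submodule.mul_smul, ← pow_succ', ← pow_succ'] at this
  obtain ⟨q, hq⟩ := exists_groupAugIdeal_pow_eq_bot p n k
  have h2 := hstab q
  rw [pow_add, hq, Ideal.mul_bot, Submodule.bot_smul, le_bot_iff] at h2
  exact hr.not_ge (Nat.sInf_le h2)

end Loewy

namespace PDGModule

section

variable {p n : ℕ} {k : Type u} [Field k]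

theorem hom_mem_augSubmodule {M : PDGModule.{u, v} p n k} {N : PDGModule.{u, w} p n k}
    (f : Hom M N) {m : M.carrier} (hm : m ∈ M.augSubmodule) : f.toLin m ∈ N.augSubmodule := by
  have := Submodule.mem_map_of_mem (f := f.toLin) hm
  rw [augSubmodule, Submodule.map_smul''] at this
  exact Submodule.smul_mono le_rfl le_top this

theorem hom_mem_augIdeal_smul {M : PDGModule.{u, v} p n k} {N : PDGModule.{u, w} p n k}
    (f : Hom M N) {m : M.carrier} (hm : m ∈ augIdeal n k • M.augSubmodule) :
    f.toLin m ∈ augIdeal n k • N.augSubmodule := by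
  have := Submodule.mem_map_of_mem (f := f.toLin) hm
  rw [Submodule.map_smul''] at this
  refine Submodule.smul_mono le_rfl ?_ this
  rintro _ ⟨y, hy, rfl⟩
  exact hom_mem_augSubmodule f hy

section Action

variable [hp : Fact p.Prime] {M : PDGModule.{u, v} p n k}
  [∀ (s : ℕ) (l : ℤ), Module (GroupAlg p n k) (M.fiber.H s l)]
  [∀ (s : ℕ) (l : ℤ), IsScalarTower k (GroupAlg p n k) (M.fiber.H s l)]

/-- Gives both kinds of strings a common form. The scalar `c` is `p - 1` or `1`; its value is
immaterial, as only membership in spans is used later. -/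
theorem CompatibleAction.exists_relation (hM : M.CompatibleAction) {l : ℤ}
    (hl : (p : ℤ) ∣ l ∨ (p : ℤ) ∣ l + 1) {q : ℕ} (hq : q = stringLen p l) {x : M.carrier}
    (hx : x ∈ M.gr (l + ((q - 1 : ℕ) : ℤ)))
    (hxc : M.fiberProj ((M.d ^ (q - 1)) x) ∈ M.fiber.cycles 1 l) {m : Fin n → M.carrier}
    (hm : ∀ i, M.fiberProj ((M.d ^ (q - 1)) (m i)) ∈ M.fiber.cycles 1 l)
    (h : ∀ i, M.fiber.homClass 1 l _ (hm i) = yElt p n k i • M.fiber.homClass 1 l _ hxc) :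
    ∃ c : k, ∃ z ∈ M.gr (l - 1 + (q : ℕ)), z ∈ M.augSubmodule ∧
      (M.d ^ q) x - c • ∑ i, (MvPolynomial.X i : MvPolynomial (Fin n) k) •
        (M.d ^ (q - 1)) (m i) - (M.d ^ q) z ∈ augIdeal n k • M.augSubmodule := by
  have hp2 := hp.out.two_le
  rw [stringLen] at hq
  split_ifs at hq with hpl
  · subst hq
    -- Pass from the degree of the last element to that of the first, where the description of `d¹`
    -- is stated.
    obtain ⟨l, rfl⟩ : ∃ l', l = l' - (p - 2 : ℕ) := ⟨l + (p - 2 : ℕ), by ring⟩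
    have hl' : l ≡ p - 2 [ZMOD p] := by
      have := (Int.modEq_zero_iff_dvd.2 hpl).add_right ((p - 2 : ℕ) : ℤ)
      rwa [sub_add_cancel, zero_add, Nat.cast_sub hp2] at this
    rw [show l - ((p - 2 : ℕ) : ℤ) + ((p - 1 - 1 : ℕ) : ℤ) = l by omega] at hx
    obtain ⟨z, hz, hzI, hzd⟩ := hM.exists_of_modEq_neg_two hl' hx hxc hm h
    refine ⟨_, z, ?_, hzI, hzd⟩
    rwa [show l - ((p - 2 : ℕ) : ℤ) - 1 + ((p - 1 : ℕ) : ℤ) =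
      l - ((p - 1 : ℕ) : ℤ) + ((p - 1 : ℕ) : ℤ) by omega]
  · subst hq
    have hl' : l ≡ p - 1 [ZMOD p] := by
      rw [Int.modEq_iff_dvd, show (p : ℤ) - 1 - l = p - (l + 1) by ring]
      exact dvd_sub_self_left.2 (hl.resolve_left hpl)
    obtain ⟨z, hz, hzI, hzd⟩ := hM.exists_of_modEq_neg_one hl' (by simpa using hx) hxc hm h
    refine ⟨1, z, by simpa using hz, hzI, ?_⟩
    rw [one_smul]
    exact hzd

end Action

end

end PDGModule

/-! ### The minimal model and its composition series -/

namespace PDGModule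

section

variable {p n : ℕ} {k : Type u} [Field k]

theorem fiberProj_strings (M : PDGModule.{u, v} p n k) {β : Type w} (len : β → ℕ)
    (top : β → M.carrier) (y : Σ x, Fin (len x)) :
    M.fiberProj (M.strings len top y) = M.fiber.strings len (fun x => M.fiberProj (top x)) y :=
  M.fiberProj_d_pow _ _

theorem strings_mem_gr (M : PDGModule.{u, v} p n k) {β : Type w} (len : β → ℕ)
    {top : β → M.carrier} {c : β → ℤ} (h : ∀ x, top x ∈ M.gr (c x)) (y : Σ x, Fin (len x)) :
    M.strings len top y ∈ M.gr (c y.1 - (y.2 : ℕ)) := M.d_pow_mem _ rfl (h _)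

/-- Representatives of bases of the homology groups `_1H_l` of the fiber can be completed to a
homogeneous basis by strings of length `p`, which split off up to homotopy. -/
theorem exists_minimal_model (hp : 2 ≤ p) {M : PDGModule.{u, v} p n k} (hfree : M.IsFree)
    (hfg : M.IsFG) (hW : M.fiber.HasBijectiveMaps) {κ : ℤ → Type v}
    {e : ∀ l, κ l → M.fiber.H 1 l} (he : ∀ l, LinearIndependent k (e l))
    (he' : ∀ l, Submodule.span k (Set.range (e l)) = ⊤) {τ : (Σ l, κ l) → M.carrier}
    (hτ : ∀ x, τ x ∈ M.gr (x.1 + ((stringLen p x.1 - 1 : ℕ) : ℤ)))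
    (hτd : ∀ x, ∃ h, M.fiber.homClass 1 x.1
      (M.fiberProj ((M.d ^ (stringLen p x.1 - 1)) (τ x))) h = e x.1 x.2) :
    Finite (Σ l, κ l) ∧ ∃ (N : PDGModule.{u, v} p n k) (f : Hom M N), M.HomotopyEquivalent N ∧
      ∃ b : Module.Basis (Σ x : Σ l, κ l, Fin (stringLen p x.1)) (MvPolynomial (Fin n) k) N.carrier,
        ∀ y, b y = (N.d ^ (y.2 : ℕ)) (f.toLin (τ y.1)) := by
  let ι : ℤ → Type v := fun l => Module.Basis.ofVectorSpaceIndex k (M.fiber.boundaries 1 l)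
  let z : ∀ l, ι l → M.fiber.boundaries 1 l := fun l i =>
    Module.Basis.ofVectorSpace k (M.fiber.boundaries 1 l) i
  have hω : ∀ x : Σ l, ι l, ∃ m ∈ M.gr (x.1 + ((p - 1 : ℕ) : ℤ)),
      (M.fiber.d ^ (p - 1)) (M.fiberProj m) = z x.1 x.2 := by
    intro x
    obtain ⟨y, hy, hyz⟩ := mem_boundaries.1 (z x.1 x.2).2
    obtain ⟨m, hm, rfl⟩ := M.exists_fiberProj_eq hy
    exact ⟨m, hm, hyz⟩
  choose ω hωgr hωd using hω
  let len : (Σ l, ι l) ⊕ (Σ l, κ l) → ℕ := Sum.elim (fun _ => p) fun x => stringLen p x.1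
  let top : (Σ l, ι l) ⊕ (Σ l, κ l) → M.carrier := Sum.elim ω τ
  let c : (Σ l, ι l) ⊕ (Σ l, κ l) → ℤ := Sum.elim (fun x => x.1 + ((p - 1 : ℕ) : ℤ))
    fun x => x.1 + ((stringLen p x.1 - 1 : ℕ) : ℤ)
  have htop : ∀ x, top x ∈ M.gr (c x) := by
    rintro (x | x)
    · exact hωgr x
    · exact hτ x
  have hτd' : ∀ x : Σ l, κ l, ∃ h, M.fiber.homClass 1 x.1
      ((M.fiber.d ^ (stringLen p x.1 - 1)) (M.fiberProj (τ x))) h = e x.1 x.2 := fun x => by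
    obtain ⟨h, hx⟩ := hτd x
    simp only [fiberProj_d_pow] at h hx
    exact ⟨h, hx⟩
  obtain ⟨hli, hspan⟩ := hW.linearIndependent_and_span_strings hp (z := z)
    (fun l => (Module.Basis.ofVectorSpace k (M.fiber.boundaries 1 l)).linearIndependent)
    (fun l => (Module.Basis.ofVectorSpace k (M.fiber.boundaries 1 l)).span_eq)
    (ω := fun x => M.fiberProj (ω x)) (fun x => M.fiberProj_mem_gr (hωgr x)) hωd he he'
    (τ := fun x => M.fiberProj (τ x)) (fun x => M.fiberProj_mem_gr (hτ x)) hτd'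
  have hstr : (fun y => M.fiberProj (M.strings len top y)) =
      M.fiber.strings len (Sum.elim (fun x => M.fiberProj (ω x)) fun x => M.fiberProj (τ x)) := by
    funext y
    rw [fiberProj_strings]
    congr 1
    funext x
    cases x <;> rfl
  obtain ⟨b, hb⟩ := M.exists_basis_of_fiber hfree hfg (M.strings_mem_gr len htop)
    (hstr ▸ hli) (hstr ▸ hspan)
  have hfin : Finite (Σ x, Fin (len x)) := by
    have : Module.Finite (MvPolynomial (Fin n) k) M.carrier := hfg
    exact Module.Finite.finite_basis b
  refine ⟨Finite.of_injective (fun x : Σ l, κ l =>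
    (⟨Sum.inr x, ⟨0, stringLen_pos hp x.1⟩⟩ : Σ x, Fin (len x))) fun x y hxy => ?_, ?_⟩
  · exact Sum.inr_injective (Sigma.mk.inj hxy).1
  · exact exists_splitting (by omega) M (len := len) (fun _ => rfl) htop b hb

section Action

variable [hp : Fact p.Prime] {M : PDGModule.{u, v} p n k}
  [∀ (s : ℕ) (l : ℤ), Module (GroupAlg p n k) (M.fiber.H s l)]
  [∀ (s : ℕ) (l : ℤ), IsScalarTower k (GroupAlg p n k) (M.fiber.H s l)]

theorem CompatibleAction.exists_compositionSeries [CharP k p] (hM : M.CompatibleAction)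
    (hfree : M.IsFree) (hfg : M.IsFG) :
    ∃ N : PDGModule.{u, v} p n k, N.IsFree ∧ N.IsFG ∧ M.HomotopyEquivalent N ∧
      N.HasCompositionSeries (∑ᶠ i : ℤ, loewyLength p n k (M.fiber.H 1 i)) := by
  have hp2 := hp.out.two_le
  have hW := hM.hasBijectiveMaps
  choose σ hσgr hσc using exists_linear_section hp2 hW
  choose s hsli hmem_range hsspan rk hrk using fun l => exists_adapted_set
    (loewyFiltration_antitone p n k (M.fiber.H 1 l)) (loewyFiltration_zero p n k (M.fiber.H 1 l))
    (loewyFiltration_loewyLength p n k (M.fiber.H 1 l))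
  let β : Type v := Σ l : ℤ, s l
  let τ : β → M.carrier := fun x => σ x.1 x.2
  let rank : β → ℕ := fun x => rk x.1 x.2
  obtain ⟨hfin, N, f, hMN, b, hb⟩ := exists_minimal_model hp2 hfree hfg hW (κ := fun l => s l)
    (e := fun l x => x.1) (fun l => hsli l)
    (fun l => by rw [Subtype.range_coe]; exact hmem_range l) (τ := τ) (fun x => hσgr x.1 x.2)
    (fun x => hσc x.1 x.2)
  have hne : ∀ x : β, (x.2 : M.fiber.H 1 x.1) ≠ 0 := fun x => (hsli x.1).ne_zero x.2.2
  have hbot : ∀ x : β, (p : ℤ) ∣ x.1 ∨ (p : ℤ) ∣ x.1 + 1 := by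
    intro x
    -- A basis element is a nonzero class, whereas `_1H_l` vanishes in all other degrees.
    by_contra! h
    obtain ⟨m, hm, hmx⟩ := M.fiber.exists_homClass (x.2 : M.fiber.H 1 x.1)
    exact hne x (hmx.symm.trans ((M.fiber.homClass_eq_zero hm).2
      (hW.cycles_le_boundaries_of_not_dvd hp2 h.1 h.2 hm)))
  have htop : ∀ x : β, f.toLin (τ x) ∈ N.gr (x.1 + ((stringLen p x.1 - 1 : ℕ) : ℤ)) := fun x =>
    f.map_gr _ _ (hσgr x.1 x.2)
  have hbgr := basis_mem_gr htop b hb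
  have hI : ∀ x : β, (N.d ^ stringLen p x.1) (f.toLin (τ x)) ∈ N.augSubmodule := by
    intro x
    rw [← hom_d_pow]
    refine hom_mem_augSubmodule f ?_
    obtain ⟨h, -⟩ := hσc x.1 x.2
    have h1 := (mem_cycles.1 h).2
    rw [← fiberProj_d_pow, fiberProj_eq_zero, ← Module.End.mul_apply, ← pow_add,
      Nat.add_sub_cancel' (stringLen_pos hp2 x.1)] at h1
    exact h1
  obtain ⟨R, hR⟩ := (Set.finite_range rank).bddAbove
  have hrel : ∀ x : β, ∃ w ∈ Submodule.span (MvPolynomial (Fin n) k)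
        ((fun x => f.toLin (τ x)) '' {y | y.1 = x.1 ∧ rank x < rank y}),
      w ∈ N.gr (x.1 + ((stringLen p x.1 - 1 : ℕ) : ℤ) - 1) ∧
      ∃ z ∈ N.gr (x.1 - 1 + (stringLen p x.1 : ℕ)), z ∈ N.augSubmodule ∧
        (N.d ^ stringLen p x.1) (f.toLin (τ x)) - (N.d ^ (stringLen p x.1 - 1)) w -
          (N.d ^ stringLen p x.1) z ∈ augIdeal n k • N.augSubmodule := by
    rintro ⟨l, ξ⟩
    choose hc hce using hσc l
    obtain ⟨a, z, hz, hzI, hzd⟩ := hM.exists_relation (hbot ⟨l, ξ⟩) rfl (hσgr l ξ) (hc ξ)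
      (fun i => hc (yElt p n k i • (ξ : M.fiber.H 1 l)))
      (fun i => (hce _).trans (congrArg _ (hce _).symm))
    let g : M.fiber.H 1 l →ₗ[k] N.carrier := f.toLin.restrictScalars k ∘ₗ σ l
    -- The witness consists of first elements, not last ones: `d` to the power length minus one
    -- turns it into the main term of the relation.
    refine ⟨a • ∑ i, (MvPolynomial.X i : MvPolynomial (Fin n) k) •
      g (yElt p n k i • (ξ : M.fiber.H 1 l)), ?_, ?_, f.toLin z, f.map_gr _ _ hz,
      hom_mem_augSubmodule f hzI, ?_⟩
    · refine Submodule.smul_of_tower_mem _ a (Submodule.sum_mem _ fun i _ =>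
        Submodule.smul_mem _ _ ?_)
      -- `y_i ξ` lies one Loewy layer deeper than `ξ`, so it is a combination of basis elements of
      -- higher rank, and the linear map `g` carries this expansion to `N`.
      have h1 := yElt_smul_mem p n k (M.fiber.H 1 l) i ((hrk l ξ (rk l ξ)).2 le_rfl)
      rw [← hsspan l] at h1
      have h2 := Submodule.mem_map_of_mem (f := g) h1
      rw [Submodule.map_span] at h2
      refine Submodule.span_le_restrictScalars k (MvPolynomial (Fin n) k) _
        (Submodule.span_mono ?_ h2)
      rintro _ ⟨η, ⟨hη, hηr⟩, rfl⟩
      exact ⟨⟨l, ⟨η, hη⟩⟩, ⟨rfl, (hrk l ⟨η, hη⟩ _).1 hηr⟩, rfl⟩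
    · exact Submodule.smul_mem _ _ (Submodule.sum_mem _ fun i _ =>
        N.X_smul_mem i _ _ (f.map_gr _ _ (hσgr l _)))
    · have h1 := hom_mem_augIdeal_smul f hzd
      have h2 : f.toLin (a • ∑ i, (MvPolynomial.X i : MvPolynomial (Fin n) k) •
          (M.d ^ (stringLen p l - 1)) (σ l (yElt p n k i • (ξ : M.fiber.H 1 l)))) =
          (N.d ^ (stringLen p l - 1)) (a • ∑ i, (MvPolynomial.X i : MvPolynomial (Fin n) k) •
            g (yElt p n k i • (ξ : M.fiber.H 1 l))) := by
        rw [LinearMap.map_smul_of_tower, LinearMap.map_smul_of_tower, map_sum, map_sum]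
        congr 1
        refine Finset.sum_congr rfl fun i _ => ?_
        rw [map_smul f.toLin, hom_d_pow]
        exact (map_smul (N.d ^ (stringLen p l - 1)) _ _).symm
      rw [map_sub, map_sub, h2, hom_d_pow, hom_d_pow] at h1
      exact h1
  have hrank := d_pow_top_mem_span_rank hp2 hbot htop b hb hI (fun x => hR ⟨x, rfl⟩) hrel
  refine ⟨N, ⟨_, b, _, hbgr⟩, Module.Finite.of_basis b, hMN,
    hasCompositionSeries_of_rank hp2 htop b hb (rk := rank) (fun l r => ⟨?_, fun hr => ?_⟩) hrank⟩
  · rintro ⟨⟨l, ξ⟩, rfl, rfl⟩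
    by_contra! h
    have h1 := (hrk l ξ _).2 h
    rw [loewyFiltration_loewyLength] at h1
    exact hne ⟨l, ξ⟩ ((Submodule.mem_bot k).1 h1)
  · by_contra! h
    -- If no basis element over `l` had rank `r`, those spanning layer `r` would all lie in layer `r
    -- + 1`, although the layers differ below the Loewy length.
    refine loewyFiltration_succ_ne p n k (M.fiber.H 1 l) hr ?_
    rw [← hsspan l r, Submodule.span_le]
    rintro η ⟨hη, hηr⟩
    refine (hrk l ⟨η, hη⟩ _).2 (Nat.lt_of_le_of_ne ((hrk l ⟨η, hη⟩ _).1 hηr) ?_)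
    exact fun h' => h ⟨l, ⟨η, hη⟩⟩ rfl h'.symm

end Action

end

end PDGModule

theorem theorem5p5 (p n : ℕ) [Fact p.Prime] (k : Type u) [Field k] [CharP k p]
    (M : PDGModule.{u, v} p n k) (hfree : M.IsFree) (hfg : M.IsFG)
    [∀ (s : ℕ) (l : ℤ), Module (GroupAlg p n k) (M.fiber.H s l)]
    [∀ (s : ℕ) (l : ℤ), IsScalarTower k (GroupAlg p n k) (M.fiber.H s l)]
    (hM : M.CompatibleAction) :
    ∃ N : PDGModule.{u, v} p n k, N.IsFree ∧ N.IsFG ∧ M.HomotopyEquivalent N ∧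
      N.HasCompositionSeries (∑ᶠ i : ℤ, loewyLength p n k (M.fiber.H 1 i)) :=
  hM.exists_compositionSeries hfree hfg
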